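/- Let $k>3$ and $d>1$ be integers, and let $\mathcal N$ be the set of positive integers $n$ such that $dn/k$ and $2n/k$ are integers. For $n\in\mathcal N$ put $m=dn/k$ and let $G$ be a uniformly random $d$-regular $k$-configuration, i.e. a uniformly random bijection $g:[n]\times[d]\to[m]\times[k]$, whose domain elements $(i,h)$ are the half-edges of the variables $i\in[n]$ and whose image elements $(a,h')$ are the half-edges of the constraints $a\in[m]$. Let $Z$ be the number of assignments $x\in\{0,1\}^n$ such that for every constraint $a\in[m]$ exactly two of its $k$ half-edges are matched by $G$ to a half-edge of a variable of value one. For $\ell\ge 1$ let $X_\ell$ be the number of (undirected) $2\ell$-cycles in $G$, i.e. of cycles in the bipartite multigraph on $[n]\sqcup[m]$ with one edge for each matched pair of half-edges that run through $\ell$ distinct variables and $\ell$ distinct constraints alternately (for $\ell=1$: pairs of parallel edges). Write $(x)_r=x(x-1)\cdots(x-r+1)$, and for $\ell\ge1$ let $$\lambda_\ell=\frac{[(k-1)(d-1)]^\ell}{2\ell},\qquad \delta_\ell=\Bigl(-\frac1{k-1}\Bigr)^{\ell},\qquad \mu_\ell=\lambda_\ell(1+\delta_\ell).$$ Then the following hold.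 (i) For every $\ell\ge1$ we have $\lambda_\ell>0$, $\delta_\ell>-1$ and $$1+\delta_\ell=\operatorname{Tr}(W^\ell),\qquad W=\begin{pmatrix}1-\frac2{k-1}&1-\frac1{k-1}\\ \frac2{k-1}&\frac1{k-1}\end{pmatrix}.$$ (ii) For every $\bar\ell$ and all non-negative integers $r_1,\dots,r_{\bar\ell}$, as $n\in\mathcal N$ tends to infinity, $$\frac{\mathbb E\bigl[Z\prod_{\ell=1}^{\bar\ell}(X_\ell)_{r_\ell}\bigr]}{\mathbb E[Z]}\sim\prod_{\ell=1}^{\bar\ell}\mu_\ell^{r_\ell}.$$ (iii) If moreover $d<k$, then the series $\sum_{\ell\ge1}\lambda_\ell\delta_\ell^2$ converges and $$\sum_{\ell=1}^\infty\lambda_\ell\delta_\ell^2=\ln\sqrt{\frac{k-1}{k-d}}.$$ -/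

import Mathlib

open Filter Asymptotics

namespace RegularOccupation

/-- A `d`-regular `k`-configuration with `n` variables and `m` constraints: a bijection from the
v-edges `(i, h)` (variable, half-edge label) to the f-edges `(a, h')` (constraint, half-edge
label). -/
abbrev Config (k d n m : ℕ) : Type := (Fin n × Fin d) ≃ (Fin m × Fin k)

/-- `x` is a solution of the 2-in-`k` occupation problem on `g`: for each constraint `a`, exactly
two of the `k` half-edges of `a` are wired to variables of value one. -/
def IsSolution {k d n m : ℕ} (g : Config k d n m) (x : Fin n → Bool) : Prop :=
  ∀ a : Fin m, (Finset.univ.filter fun h : Fin k => x (g.symm (a, h)).1 = true).card = 2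

/-- The number `Z` of solutions. -/
noncomputable def numSolutions {k d n m : ℕ} (g : Config k d n m) : ℕ :=
  {x : Fin n → Bool | IsSolution g x}.ncard

/-- A directed `2ℓ`-cycle of `g` based at a variable: it traverses
`var 0, con 0, var 1, con 1, …, var (ℓ-1), con (ℓ-1)` and returns to `var 0`, all variables and all
constraints being distinct. It leaves `var j` through the half-edge `out j` towards `con j`, and
enters `var (j+1)` from `con j` through the half-edge `inc (j+1)` (indices modulo `ℓ`). The two
f-edges used at each constraint are the images of two distinct v-edges under `g`, hence distinct.
For `ℓ = 1` this is a pair of parallel connections between a variable and a constraint. -/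
structure DirectedCycle {k d n m : ℕ} (g : Config k d n m) (ℓ : ℕ) where
  var : Fin ℓ → Fin n
  con : Fin ℓ → Fin m
  out : Fin ℓ → Fin d
  inc : Fin ℓ → Fin d
  var_injective : Function.Injective var
  con_injective : Function.Injective con
  out_ne_inc : ∀ j, out j ≠ inc j
  out_wired : ∀ j, (g (var j, out j)).1 = con j
  inc_wired : ∀ j, (g (var (finRotate ℓ j), inc (finRotate ℓ j))).1 = con j

/-- The v-edges traversed by a directed cycle. -/
def DirectedCycle.edges {k d n m : ℕ} {g : Config k d n m} {ℓ : ℕ} (γ : DirectedCycle g ℓ) :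
    Set (Fin n × Fin d) :=
  {e | ∃ j, e = (γ.var j, γ.out j) ∨ e = (γ.var j, γ.inc j)}

/-- The number `X_ℓ` of (undirected) `2ℓ`-cycles in `g`. As in any graph, an undirected cycle is
identified with its set of edges; in a configuration an edge is given by its v-edge. -/
noncomputable def numCycles {k d n m : ℕ} (ℓ : ℕ) (g : Config k d n m) : ℕ :=
  {c : Set (Fin n × Fin d) | ∃ γ : DirectedCycle g ℓ, γ.edges = c}.ncard

/-- Expectation with respect to the uniform distribution on the set of configurations. -/
noncomputable def expect {k d n m : ℕ} (f : Config k d n m → ℝ) : ℝ :=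
  (∑ g : Config k d n m, f g) / (Fintype.card (Config k d n m) : ℝ)

/-- The admissible numbers `n` of variables: `d n / k` and `2 n / k` are positive integers
(for positive `d` and `k`). -/
def admissible (k d : ℕ) : Set ℕ := {n | 0 < n ∧ k ∣ d * n ∧ k ∣ 2 * n}

/-- `λ_ℓ`. -/
noncomputable def lam (k d ℓ : ℕ) : ℝ := (((k : ℝ) - 1) * ((d : ℝ) - 1)) ^ ℓ / (2 * (ℓ : ℝ))

/-- `δ_ℓ`. -/
noncomputable def delta (k ℓ : ℕ) : ℝ := (-1 / ((k : ℝ) - 1)) ^ ℓ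

/-- `μ_ℓ`. -/
noncomputable def mu (k d ℓ : ℕ) : ℝ := lam k d ℓ * (1 + delta k ℓ)

/-- The column stochastic transition matrix of the two-state Markov chain. -/
noncomputable def transition (k : ℕ) : Matrix (Fin 2) (Fin 2) ℝ :=
  !![1 - 2 / ((k : ℝ) - 1), 1 - 1 / ((k : ℝ) - 1);
     2 / ((k : ℝ) - 1), 1 / ((k : ℝ) - 1)]

end RegularOccupation

/-!
The second moment method for the two-in-`k` occupation problem needs the joint factorial moments of
the numbers of short cycles under the planted distribution, in which a configuration is weighted by
its number of solutions. The moments are computed for each assignment `x` separately. Only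
assignments that are `Balanced` (the half-edges of value one number twice the constraints) can be
solutions, and for each of them the normalized moment has the same limit.

**Directed cycles.** An undirected cycle of length `2ℓ` underlies `2ℓ` directed ones
(`DirectedCycle.card_edges_eq`), so the product of falling factorials counts, up to the factor
`∏ (2ℓ) ^ r ℓ`, families of directed cycles with distinct edge sets (`numFamilies_sigma`).

**Vertex-disjoint families.** A configuration with solution `x` is a bijection of half-edges which
transports the values of `x` to a pattern of two marks at each constraint. The bijections that
respect two colourings and extend a given partial injection are counted by factorials
(`card_equiv_extending`). Summing over all placements of vertex-disjoint cycles gives an exact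
formula (`sum_card_realized`), a sum over the values `y` that `x` takes along the cycles. It is
exact because the number of pairs of half-edges of a constraint with given values is the same for
each pattern. As `n` tends to infinity the summand of `y` tends to a product of step weights along
the cycles (`tendsto_placementMean`), so that the sum becomes a product of traces of powers of the
`2 × 2` matrix `(d - 1) (1 rᵀ - 1)`, where `r = (2, k - 2)`. The matrix `1 rᵀ` has rank one and
trace `k`, hence the eigenvalues are `(d - 1)(k - 1)` and `-(d - 1)`, and the trace of the `ℓ`-th power is
`2ℓ μ_ℓ`.

**Overlapping families.** The union of distinct cycles that are not vertex-disjoint has more edges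
than vertices (`Family.card_var_add_card_con_lt`). There are `O(n ^ v)` ways to place `v` vertices,
and `e` prescribed edges are present with probability `O(n ^ (-e))`, so these families contribute
`O(1 / n)` (`sum_card_overlapping_le`).
-/

namespace RegularOccupation

/-! ### Counting bijections that respect a colouring -/

open Nat in
theorem card_equiv_comp_eq {α β κ : Type*} [Finite α] [Finite β] [Fintype κ]
    (f : α → κ) (h : β → κ)
    (hcard : ∀ c, Nat.card {x // f x = c} = Nat.card {y // h y = c}) :
    Nat.card {g : α ≃ β // ∀ x, h (g x) = f x} = ∏ c, (Nat.card {x // f x = c})! := by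
  classical
  cases nonempty_fintype α
  cases nonempty_fintype β
  have e : ∀ c, {x // f x = c} ≃ {y // h y = c} := fun c => (Finite.card_eq.mp (hcard c)).some
  let g₀ : α ≃ β := Equiv.ofFiberEquiv e
  have hg₀ : ∀ x, h (g₀ x) = f x := Equiv.ofFiberEquiv_map e
  have key : Nat.card {g : α ≃ β // ∀ x, h (g x) = f x} =
      Nat.card {σ : Equiv.Perm α // f ∘ σ = f} := by
    refine Nat.card_congr
      { toFun := fun g => ⟨g.1.trans g₀.symm, ?_⟩
        invFun := fun σ => ⟨σ.1.trans g₀, ?_⟩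
        left_inv := fun g => by ext; simp
        right_inv := fun σ => by ext; simp }
    · funext x
      have := hg₀ (g₀.symm (g.1 x))
      simp only [Equiv.apply_symm_apply] at this
      simp [← this, g.2]
    · intro x
      simpa [hg₀] using congrFun σ.2 x
  rw [key, Nat.card_eq_fintype_card, DomMulAct.stabilizer_card]
  simp [Nat.card_eq_fintype_card]

/-- The colouring that gives each `a i` a private colour `i` and keeps `f` elsewhere. A bijection
respects the refined colourings exactly if it respects the original ones and maps `a i` to `b i`. -/
noncomputable def refined {α κ ι : Type*} (f : α → κ) (a : ι → α) : α → κ ⊕ ι :=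
  Function.extend a Sum.inr (fun x => Sum.inl (f x))

section refined

variable {α β κ ι : Type*} (f : α → κ) (h : β → κ)

theorem refined_apply {a : ι → α} (ha : a.Injective) (i : ι) : refined f a (a i) = Sum.inr i :=
  ha.extend_apply _ _ _

theorem refined_of_notMem {a : ι → α} {x : α} (hx : ¬∃ i, a i = x) :
    refined f a x = Sum.inl (f x) :=
  Function.extend_apply' _ _ _ hx

theorem refined_eq_inr {a : ι → α} (ha : a.Injective) {x : α} {i : ι} :
    refined f a x = Sum.inr i ↔ x = a i := by
  constructor
  · intro hx
    by_cases h : ∃ j, a j = x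
    · obtain ⟨j, rfl⟩ := h
      rw [refined_apply f ha] at hx
      rw [Sum.inr.inj hx]
    · rw [refined_of_notMem f h] at hx
      cases hx
  · rintro rfl
    exact refined_apply f ha i

theorem refined_eq_inl {a : ι → α} (ha : a.Injective) {x : α} {c : κ} :
    refined f a x = Sum.inl c ↔ (¬∃ i, a i = x) ∧ f x = c := by
  by_cases h : ∃ j, a j = x
  · obtain ⟨j, rfl⟩ := h
    simp [refined_apply f ha]
  · simp [refined_of_notMem f h, h]

theorem refined_equiv_iff {a : ι → α} {b : ι → β} (ha : a.Injective) (hb : b.Injective)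
    (hab : ∀ i, h (b i) = f (a i)) (g : α ≃ β) :
    (∀ x, refined h b (g x) = refined f a x) ↔ (∀ x, h (g x) = f x) ∧ ∀ i, g (a i) = b i := by
  constructor
  · intro hg
    have h2 : ∀ i, g (a i) = b i := fun i => by
      have := hg (a i)
      rw [refined_apply f ha] at this
      exact (refined_eq_inr h hb).mp this
    refine ⟨fun x => ?_, h2⟩
    by_cases hx : ∃ i, a i = x
    · obtain ⟨i, rfl⟩ := hx
      rw [h2, hab]
    · have := hg x
      rw [refined_of_notMem f hx] at this
      exact ((refined_eq_inl h hb).mp this).2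
  · rintro ⟨h1, h2⟩ x
    by_cases hx : ∃ i, a i = x
    · obtain ⟨i, rfl⟩ := hx
      rw [refined_apply f ha, h2, refined_apply h hb]
    · rw [refined_of_notMem f hx, refined_eq_inl h hb]
      refine ⟨?_, h1 x⟩
      rintro ⟨i, hi⟩
      exact hx ⟨i, g.injective (by rw [h2, hi])⟩

theorem card_refined_inl [Finite α] [Finite ι] {a : ι → α} (ha : a.Injective) (c : κ) :
    Nat.card {x // refined f a x = Sum.inl c} + Nat.card {i // f (a i) = c} =
      Nat.card {x // f x = c} := by
  rw [← Nat.card_sum]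
  refine Nat.card_eq_of_bijective
    (Sum.elim (fun x => ⟨x.1, ((refined_eq_inl f ha).mp x.2).2⟩) (fun i => ⟨a i.1, i.2⟩)) ⟨?_, ?_⟩
  · rintro (x | i) (y | j) hxy <;> simp only [Sum.elim_inl, Sum.elim_inr, Subtype.mk.injEq] at hxy
    · exact congrArg _ (Subtype.ext hxy)
    · exact absurd ⟨_, hxy.symm⟩ ((refined_eq_inl f ha).mp x.2).1
    · exact absurd ⟨_, hxy⟩ ((refined_eq_inl f ha).mp y.2).1
    · exact congrArg _ (Subtype.ext (ha hxy))
  · rintro ⟨x, hx⟩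
    by_cases h : ∃ i, a i = x
    · obtain ⟨i, rfl⟩ := h
      exact ⟨Sum.inr ⟨i, hx⟩, rfl⟩
    · exact ⟨Sum.inl ⟨x, (refined_eq_inl f ha).mpr ⟨h, hx⟩⟩, rfl⟩

theorem card_refined_inr {a : ι → α} (ha : a.Injective) (i : ι) :
    Nat.card {x // refined f a x = Sum.inr i} = 1 := by
  simp [refined_eq_inr f ha]

end refined

/-- The number of colour-preserving bijections with prescribed values `b i` at the points `a i`,
multiplied by the falling factorials which turn it into the number of all colour-preserving
bijections. -/
theorem card_equiv_extending {α β κ ι : Type*} [Finite α] [Finite β] [Fintype κ] [Fintype ι]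
    (f : α → κ) (h : β → κ)
    (hcard : ∀ c, Nat.card {x // f x = c} = Nat.card {y // h y = c})
    {a : ι → α} {b : ι → β} (ha : a.Injective) (hb : b.Injective)
    (hab : ∀ i, h (b i) = f (a i)) :
    Nat.card {g : α ≃ β // (∀ x, h (g x) = f x) ∧ ∀ i, g (a i) = b i} *
        ∏ c, (Nat.card {x // f x = c}).descFactorial (Nat.card {i // f (a i) = c}) =
      ∏ c, (Nat.card {x // f x = c}).factorial := by
  have e : Nat.card {g : α ≃ β // (∀ x, h (g x) = f x) ∧ ∀ i, g (a i) = b i} =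
      Nat.card {g : α ≃ β // ∀ x, refined h b (g x) = refined f a x} :=
    Nat.card_congr (Equiv.subtypeEquivRight fun g => (refined_equiv_iff f h ha hb hab g).symm)
  rw [e, card_equiv_comp_eq]
  · rw [Fintype.prod_sum_type]
    simp only [card_refined_inr f ha, Nat.factorial_one, Finset.prod_const_one, mul_one]
    rw [← Finset.prod_mul_distrib]
    refine Finset.prod_congr rfl fun c _ => ?_
    rw [← card_refined_inl f ha c]
    conv_rhs => rw [← Nat.factorial_mul_descFactorial (Nat.le_add_left _ _)]
    rw [Nat.add_sub_cancel]
  · rintro (c | i)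
    · have h1 := card_refined_inl f ha c
      have h2 := card_refined_inl h hb c
      simp only [hab] at h2
      have := hcard c
      omega
    · rw [card_refined_inr f ha, card_refined_inr h hb]

/-- Injections that carry the colouring `y` to the colouring `x` are families of injections between
the colour classes. -/
theorem card_embedding_comp_eq {α β κ : Type*} [Finite α] [Finite β] [Fintype κ]
    (y : α → κ) (x : β → κ) :
    Nat.card {v : α ↪ β // ∀ p, x (v p) = y p} =
      ∏ c, (Nat.card {b // x b = c}).descFactorial (Nat.card {p // y p = c}) := by
  classical
  cases nonempty_fintype α
  cases nonempty_fintype β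
  have e : {v : α ↪ β // ∀ p, x (v p) = y p} ≃ (∀ c, {p // y p = c} ↪ {b // x b = c}) :=
    { toFun := fun v c => ⟨fun p => ⟨v.1 p.1, by rw [v.2, p.2]⟩, fun p q hpq => by
        simpa [Subtype.ext_iff] using hpq⟩
      invFun := fun w => ⟨⟨fun p => (w (y p) ⟨p, rfl⟩).1, fun p q hpq => by
        have key : ∀ c c' (p : {p // y p = c}) (q : {p // y p = c'}),
            (w c p).1 = (w c' q).1 → p.1 = q.1 := by
          intro c c' p q h
          have hc : c = c' := by rw [← (w c p).2, ← (w c' q).2, h]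
          subst hc
          exact congrArg Subtype.val ((w c).injective (Subtype.ext h))
        exact key _ _ _ _ hpq⟩, fun p => (w (y p) ⟨p, rfl⟩).2⟩
      left_inv := fun v => by ext; rfl
      right_inv := fun w => by
        funext c
        ext ⟨p, rfl⟩
        rfl }
  rw [Nat.card_congr e, Nat.card_pi]
  refine Finset.prod_congr rfl fun c _ => ?_
  rw [Nat.card_eq_fintype_card, Fintype.card_embedding_eq, Nat.card_eq_fintype_card,
    Nat.card_eq_fintype_card]

/-! ### Directed and undirected cycles -/

namespace DirectedCycle

variable {k d n m : ℕ} {g : Config k d n m} {ℓ : ℕ}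

theorem ext_of_eq {γ γ' : DirectedCycle g ℓ} (hv : γ.var = γ'.var) (ho : γ.out = γ'.out)
    (hi : γ.inc = γ'.inc) : γ = γ' := by
  have hc : γ.con = γ'.con := by
    funext j
    rw [← γ.out_wired, ← γ'.out_wired, hv, ho]
  cases γ
  cases γ'
  cases hv
  cases ho
  cases hi
  cases hc
  rfl

instance : Finite (DirectedCycle g ℓ) :=
  Finite.of_injective (fun γ => (γ.var, γ.out, γ.inc)) fun γ γ' h => by
    simp only [Prod.mk.injEq] at h
    exact ext_of_eq h.1 h.2.1 h.2.2

/-- The two edges of a directed cycle at its `j`-th variable, the outgoing one for `true` and the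
incoming one for `false`. -/
def edge (γ : DirectedCycle g ℓ) (q : Fin ℓ × Bool) : Fin n × Fin d :=
  (γ.var q.1, bif q.2 then γ.out q.1 else γ.inc q.1)

theorem edge_injective (γ : DirectedCycle g ℓ) : γ.edge.Injective := by
  rintro ⟨j, b⟩ ⟨j', b'⟩ h
  simp only [edge, Prod.mk.injEq] at h
  obtain rfl := γ.var_injective h.1
  have := γ.out_ne_inc j
  cases b <;> cases b' <;> simp_all

theorem range_edge (γ : DirectedCycle g ℓ) : Set.range γ.edge = γ.edges := by
  ext e
  simp only [Set.mem_range, Prod.exists, Bool.exists_bool, edge, edges, Set.mem_ofPred_eq,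
    cond_true, cond_false]
  refine exists_congr fun j => ?_
  rw [or_comm, eq_comm, eq_comm (a := (γ.var j, γ.inc j))]

theorem out_mem (γ : DirectedCycle g ℓ) (j : Fin ℓ) : (γ.var j, γ.out j) ∈ γ.edges :=
  ⟨j, Or.inl rfl⟩

theorem inc_mem (γ : DirectedCycle g ℓ) (j : Fin ℓ) : (γ.var j, γ.inc j) ∈ γ.edges :=
  ⟨j, Or.inr rfl⟩

theorem ncard_edges (γ : DirectedCycle g ℓ) : γ.edges.ncard = 2 * ℓ := by
  rw [← range_edge, ← Set.image_univ, Set.ncard_image_of_injective _ γ.edge_injective,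
    Set.ncard_univ]
  simp [mul_comm]

theorem eq_of_mem_edges_of_var (γ : DirectedCycle g ℓ) {e : Fin n × Fin d} (he : e ∈ γ.edges)
    {j : Fin ℓ} (hj : e.1 = γ.var j) : e = (γ.var j, γ.out j) ∨ e = (γ.var j, γ.inc j) := by
  obtain ⟨j', rfl | rfl⟩ := he <;> obtain rfl := γ.var_injective hj <;> simp

theorem eq_of_mem_edges_of_con (γ : DirectedCycle g ℓ) {e : Fin n × Fin d} (he : e ∈ γ.edges)
    {j : Fin ℓ} (hj : (g e).1 = γ.con j) :
    e = (γ.var j, γ.out j) ∨ e = (γ.var (finRotate ℓ j), γ.inc (finRotate ℓ j)) := by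
  obtain ⟨j', rfl | rfl⟩ := he
  · rw [γ.out_wired] at hj
    obtain rfl := γ.con_injective hj
    exact Or.inl rfl
  · obtain ⟨j', rfl⟩ := (finRotate ℓ).surjective j'
    rw [γ.inc_wired] at hj
    obtain rfl := γ.con_injective hj
    exact Or.inr rfl

theorem out_edge_ne_inc_edge (γ : DirectedCycle g ℓ) (j : Fin ℓ) :
    (γ.var j, γ.out j) ≠ (γ.var (finRotate ℓ j), γ.inc (finRotate ℓ j)) := by
  intro h
  rw [Prod.mk.injEq] at h
  have hj := γ.var_injective h.1
  have := h.2
  rw [← hj] at this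
  exact γ.out_ne_inc j this

/-- A directed cycle is determined by its set of edges and its first outgoing edge. -/
theorem eq_of_edges_eq {s : ℕ} {γ γ' : DirectedCycle g (s + 1)} (he : γ.edges = γ'.edges)
    (hv : γ.var 0 = γ'.var 0) (ho : γ.out 0 = γ'.out 0) : γ = γ' := by
  have hinc : ∀ j, γ.var j = γ'.var j → γ.out j = γ'.out j → γ.inc j = γ'.inc j := by
    intro j h1 h2
    have hm := γ.inc_mem j
    rw [he] at hm
    rcases γ'.eq_of_mem_edges_of_var hm h1 with h | h
    · rw [Prod.mk.injEq, ← h2] at h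
      exact absurd h.2.symm (γ.out_ne_inc j)
    · exact (Prod.mk.inj h).2
  have key : ∀ j : Fin (s + 1), γ.var j = γ'.var j ∧ γ.out j = γ'.out j := by
    intro j
    induction j using Fin.induction with
    | zero => exact ⟨hv, ho⟩
    | succ j ih =>
      have hrot : finRotate (s + 1) j.castSucc = j.succ := by
        rw [finRotate_apply, Fin.coeSucc_eq_succ]
      have hcon : γ.con j.castSucc = γ'.con j.castSucc := by
        rw [← γ.out_wired, ← γ'.out_wired, ih.1, ih.2]
      have hm := γ.inc_mem j.succ
      rw [he] at hm
      have hw := γ.inc_wired j.castSucc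
      rw [hrot, hcon] at hw
      have hne := γ.out_edge_ne_inc_edge j.castSucc
      rw [hrot] at hne
      rcases γ'.eq_of_mem_edges_of_con hm hw with h | h
      · rw [← ih.1, ← ih.2] at h
        exact absurd h.symm hne
      · rw [hrot, Prod.mk.injEq] at h
        refine ⟨h.1, ?_⟩
        have hm := γ.out_mem j.succ
        rw [he] at hm
        rcases γ'.eq_of_mem_edges_of_var hm h.1 with h' | h'
        · exact (Prod.mk.inj h').2
        · rw [Prod.mk.injEq, ← h.2] at h'
          exact absurd h'.2 (γ.out_ne_inc _)
  exact ext_of_eq (funext fun j => (key j).1) (funext fun j => (key j).2)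
    (funext fun j => hinc j (key j).1 (key j).2)

/-- The same cycle based at its `t`-th variable. -/
def rotate {s : ℕ} (γ : DirectedCycle g (s + 1)) (t : Fin (s + 1)) : DirectedCycle g (s + 1) where
  var j := γ.var (j + t)
  con j := γ.con (j + t)
  out j := γ.out (j + t)
  inc j := γ.inc (j + t)
  var_injective i j h := add_right_cancel (γ.var_injective h)
  con_injective i j h := add_right_cancel (γ.con_injective h)
  out_ne_inc j := γ.out_ne_inc _
  out_wired j := γ.out_wired _
  inc_wired j := by
    have := γ.inc_wired (j + t)
    rw [finRotate_apply] at this ⊢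
    rwa [add_right_comm]

/-- The same cycle traversed in the opposite direction. -/
def reverse {s : ℕ} (γ : DirectedCycle g (s + 1)) : DirectedCycle g (s + 1) where
  var j := γ.var (-j)
  con j := γ.con (-j - 1)
  out j := γ.inc (-j)
  inc j := γ.out (-j)
  var_injective i j h := neg_injective (γ.var_injective h)
  con_injective i j h := neg_injective (sub_left_injective (γ.con_injective h))
  out_ne_inc j := (γ.out_ne_inc _).symm
  out_wired j := by
    have := γ.inc_wired (-j - 1)
    rwa [finRotate_apply, sub_add_cancel] at this
  inc_wired j := by
    have := γ.out_wired (-j - 1)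
    rwa [finRotate_apply, neg_add']

theorem edges_rotate {s : ℕ} (γ : DirectedCycle g (s + 1)) (t : Fin (s + 1)) :
    (γ.rotate t).edges = γ.edges := by
  ext e
  exact (Equiv.addRight t).exists_congr_left.trans (by simp [rotate, edges])

theorem edges_reverse {s : ℕ} (γ : DirectedCycle g (s + 1)) : γ.reverse.edges = γ.edges := by
  ext e
  refine (Equiv.neg (Fin (s + 1))).exists_congr_left.trans ?_
  simp [reverse, edges, or_comm]

/-- Each undirected cycle of length `2ℓ` underlies exactly `2ℓ` directed cycles, one for each choice
of the first outgoing edge. -/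
theorem card_edges_eq (hℓ : 0 < ℓ) (γ : DirectedCycle g ℓ) :
    Nat.card {γ' : DirectedCycle g ℓ // γ'.edges = γ.edges} = 2 * ℓ := by
  obtain ⟨s, rfl⟩ := Nat.exists_eq_add_one.mpr hℓ
  rw [← γ.ncard_edges, ← Nat.card_coe_set_eq]
  refine Nat.card_eq_of_bijective
    (fun γ' => ⟨(γ'.1.var 0, γ'.1.out 0), (Set.ext_iff.mp γ'.2 _).mp (γ'.1.out_mem 0)⟩) ⟨?_, ?_⟩
  · rintro ⟨γ₁, h₁⟩ ⟨γ₂, h₂⟩ h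
    simp only [Subtype.mk.injEq, Prod.mk.injEq] at h
    exact Subtype.ext (eq_of_edges_eq (h₁.trans h₂.symm) h.1 h.2)
  · rintro ⟨e, j, rfl | rfl⟩
    · exact ⟨⟨γ.rotate j, γ.edges_rotate j⟩, by simp [rotate]⟩
    · exact ⟨⟨(γ.rotate j).reverse, by rw [edges_reverse, edges_rotate]⟩,
        by simp [rotate, reverse]⟩

end DirectedCycle

/-- If all fibres of `e : A → B` over its range have `c` elements, then the tuples in `A` whose
images are distinct are counted by falling factorials of the cardinality of the range. -/
theorem card_injective_comp {A B : Type*} [Finite A] [Finite B] (e : A → B) (c r : ℕ)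
    (hc : ∀ a, Nat.card {a' // e a' = e a} = c) :
    Nat.card {f : Fin r → A // (fun i => e (f i)).Injective} =
      c ^ r * (Set.range e).ncard.descFactorial r := by
  classical
  cases nonempty_fintype (Set.range e)
  have h1 : {f : Fin r → A // (fun i => e (f i)).Injective} ≃
      Σ φ : Fin r ↪ Set.range e, ∀ i, {a // e a = φ i} :=
    { toFun := fun f => ⟨⟨fun i => ⟨e (f.1 i), Set.mem_range_self _⟩, fun i j h => by
        exact f.2 (congrArg Subtype.val h)⟩, fun i => ⟨f.1 i, rfl⟩⟩
      invFun := fun w => ⟨fun i => (w.2 i).1, fun i j h => by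
        have h : e (w.2 i).1 = e (w.2 j).1 := h
        rw [(w.2 i).2, (w.2 j).2] at h
        exact w.1.injective (Subtype.ext h)⟩
      left_inv := fun f => rfl
      right_inv := by
        rintro ⟨⟨φ, hφ⟩, w⟩
        obtain ⟨a, ha, rfl⟩ : ∃ (a : Fin r → A) (ha : ∀ i, e (a i) = φ i),
            w = fun i => ⟨a i, ha i⟩ := ⟨fun i => (w i).1, fun i => (w i).2, rfl⟩
        obtain rfl : φ = fun i => ⟨e (a i), Set.mem_range_self _⟩ :=
          funext fun i => Subtype.ext (ha i).symm
        rfl }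
  rw [Nat.card_congr h1, Nat.card_sigma]
  have h2 : ∀ φ : Fin r ↪ Set.range e, Nat.card (∀ i, {a // e a = φ i}) = c ^ r := by
    intro φ
    rw [Nat.card_pi, Finset.prod_congr rfl (g := fun _ => c), Finset.prod_const, Finset.card_univ,
      Fintype.card_fin]
    intro i _
    obtain ⟨a, ha⟩ := (φ i).2
    rw [← ha, hc]
  rw [Finset.sum_congr rfl fun φ _ => h2 φ, Finset.sum_const, Finset.card_univ,
    Fintype.card_embedding_eq, Fintype.card_fin, smul_eq_mul, mul_comm, ← Nat.card_coe_set_eq,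
    Nat.card_eq_fintype_card]

/-- The number of `r`-tuples of directed cycles of length `2ℓ` whose underlying undirected cycles
are distinct. -/
theorem card_tuples_of_cycles {k d n m : ℕ} {ℓ : ℕ} (hℓ : 0 < ℓ) (g : Config k d n m) (r : ℕ) :
    Nat.card {f : Fin r → DirectedCycle g ℓ // (fun i => (f i).edges).Injective} =
      (2 * ℓ) ^ r * (numCycles ℓ g).descFactorial r :=
  card_injective_comp _ _ _ fun γ => γ.card_edges_eq hℓ

/-! ### Solutions as colour-preserving bijections -/

/-- A pattern marks exactly two half-edges at each of the `m` constraints. The solutions `x` of `g`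
are the assignments for which `g` transports the values of `x` to the marks of some pattern. -/
abbrev Pattern (k m : ℕ) : Type :=
  Fin m → {ρ : Fin k → Bool // (Finset.univ.filter fun h => ρ h = true).card = 2}

/-- The number of half-edges at one constraint that take the value `b`. -/
def rowSize (k : ℕ) (b : Bool) : ℕ := bif b then 2 else k - 2

/-- The number of half-edges that take the value `b`, over all constraints. -/
def classSize (k m : ℕ) (b : Bool) : ℕ := m * rowSize k b

/-- The configuration `g` transports the values of `x` to the marks of `τ`. -/
def Transports {k d n m : ℕ} (τ : Pattern k m) (x : Fin n → Bool) (g : Config k d n m) : Prop :=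
  ∀ e, (τ (g e).1).1 (g e).2 = x e.1

theorem card_row {k : ℕ} (ρ : Fin k → Bool)
    (hρ : (Finset.univ.filter fun h => ρ h = true).card = 2) (b : Bool) :
    (Finset.univ.filter fun h => ρ h = b).card = rowSize k b := by
  cases b
  · have := Finset.card_filter_add_card_filter_not (s := (Finset.univ : Finset (Fin k)))
      (fun h => ρ h = true)
    simp only [Bool.not_eq_true, Finset.card_univ, Fintype.card_fin] at this
    simp only [rowSize, cond_false]
    omega
  · simpa [rowSize] using hρ

theorem card_pattern_class {k m : ℕ} (τ : Pattern k m) (b : Bool) :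
    Nat.card {e : Fin m × Fin k // (τ e.1).1 e.2 = b} = classSize k m b := by
  have e : {e : Fin m × Fin k // (τ e.1).1 e.2 = b} ≃ Σ a : Fin m, {h // (τ a).1 h = b} :=
    { toFun := fun e => ⟨e.1.1, e.1.2, e.2⟩
      invFun := fun e => ⟨(e.1, e.2.1), e.2.2⟩
      left_inv := fun _ => rfl
      right_inv := fun _ => rfl }
  rw [Nat.card_congr e, Nat.card_sigma]
  have : ∀ a : Fin m, Nat.card {h // (τ a).1 h = b} = rowSize k b := fun a => by
    rw [Nat.card_eq_fintype_card, Fintype.card_subtype, card_row _ (τ a).2]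
  simp only [this]
  simp [classSize]

theorem card_var_class {n : ℕ} (d : ℕ) (x : Fin n → Bool) (b : Bool) :
    Nat.card {e : Fin n × Fin d // x e.1 = b} = d * Nat.card {i // x i = b} := by
  have e : {e : Fin n × Fin d // x e.1 = b} ≃ {i // x i = b} × Fin d :=
    { toFun := fun e => (⟨e.1.1, e.2⟩, e.1.2)
      invFun := fun e => ⟨(e.1.1, e.2), e.1.2⟩
      left_inv := fun _ => rfl
      right_inv := fun _ => rfl }
  rw [Nat.card_congr e, Nat.card_prod, mul_comm, Nat.card_eq_fintype_card (α := Fin d),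
    Fintype.card_fin]

/-- The assignment `x` has as many half-edges of each value as any pattern. -/
def Balanced (k d m : ℕ) {n : ℕ} (x : Fin n → Bool) : Prop :=
  ∀ b, d * Nat.card {i // x i = b} = classSize k m b

section

variable {k d n m : ℕ}

theorem Transports.balanced {τ : Pattern k m} {x : Fin n → Bool} {g : Config k d n m}
    (h : Transports τ x g) : Balanced k d m x := by
  intro b
  rw [← card_var_class, ← card_pattern_class τ]
  exact Nat.card_congr (g.subtypeEquiv fun e => by rw [h e])

theorem Transports.pattern_eq {τ τ' : Pattern k m} {x : Fin n → Bool} {g : Config k d n m}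
    (h : Transports τ x g) (h' : Transports τ' x g) : τ = τ' := by
  funext a
  refine Subtype.ext (funext fun b => ?_)
  have h1 := h (g.symm (a, b))
  have h2 := h' (g.symm (a, b))
  rw [Equiv.apply_symm_apply] at h1 h2
  exact h1.trans h2.symm

theorem isSolution_iff_exists_transports (g : Config k d n m) (x : Fin n → Bool) :
    IsSolution g x ↔ ∃ τ : Pattern k m, Transports τ x g := by
  constructor
  · intro h
    exact ⟨fun a => ⟨fun b => x (g.symm (a, b)).1, h a⟩, fun e => by simp⟩
  · rintro ⟨τ, hτ⟩ a
    rw [← (τ a).2]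
    congr 1
    ext b
    have h1 := hτ (g.symm (a, b))
    rw [Equiv.apply_symm_apply] at h1
    simp [h1]

theorem IsSolution.balanced {g : Config k d n m} {x : Fin n → Bool} (h : IsSolution g x) :
    Balanced k d m x :=
  ((isSolution_iff_exists_transports g x).mp h).choose_spec.balanced

/-- Sorting the solutions with a given property by their pattern. -/
theorem card_isSolution_and (x : Fin n → Bool) (q : Config k d n m → Prop) :
    Nat.card {g : Config k d n m // IsSolution g x ∧ q g} =
      ∑ τ : Pattern k m, Nat.card {g : Config k d n m // Transports τ x g ∧ q g} := by
  rw [← Nat.card_sigma]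
  refine (Nat.card_eq_of_bijective (fun w => ⟨w.2.1,
    (isSolution_iff_exists_transports _ _).mpr ⟨w.1, w.2.2.1⟩, w.2.2.2⟩) ⟨?_, ?_⟩).symm
  · rintro ⟨τ, g, hg⟩ ⟨τ', g', hg'⟩ h
    obtain rfl : g = g' := congrArg Subtype.val h
    obtain rfl := hg.1.pattern_eq hg'.1
    rfl
  · rintro ⟨g, hg, hq⟩
    obtain ⟨τ, hτ⟩ := (isSolution_iff_exists_transports _ _).mp hg
    exact ⟨⟨τ, g, hτ, hq⟩, rfl⟩

/-- The number of configurations which transport `x` to `τ` and have prescribed values on a set of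
half-edges is zero or given by factorials. -/
theorem card_transports_extending {ι : Type*} [Fintype ι] {x : Fin n → Bool}
    (hx : Balanced k d m x) (τ : Pattern k m) {a : ι → Fin n × Fin d} {b : ι → Fin m × Fin k}
    (ha : a.Injective) (hb : b.Injective) [Decidable (∀ i, (τ (b i).1).1 (b i).2 = x (a i).1)] :
    Nat.card {g : Config k d n m // Transports τ x g ∧ ∀ i, g (a i) = b i} *
        ∏ c, (classSize k m c).descFactorial (Nat.card {i // x (a i).1 = c}) =
      if ∀ i, (τ (b i).1).1 (b i).2 = x (a i).1 then ∏ c, (classSize k m c).factorial else 0 := by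
  split_ifs with hab
  · have h := card_equiv_extending (fun e : Fin n × Fin d => x e.1)
      (fun e : Fin m × Fin k => (τ e.1).1 e.2)
      (fun c => by rw [card_var_class, hx, card_pattern_class]) ha hb hab
    simp only [card_var_class, hx _] at h
    exact h
  · have : IsEmpty {g : Config k d n m // Transports τ x g ∧ ∀ i, g (a i) = b i} := by
      refine ⟨fun g => hab fun i => ?_⟩
      have := g.2.1 (a i)
      rwa [g.2.2 i] at this
    rw [Nat.card_of_isEmpty, zero_mul]

theorem card_isSolution {x : Fin n → Bool} (hx : Balanced k d m x) :
    Nat.card {g : Config k d n m // IsSolution g x} =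
      Nat.card (Pattern k m) * ∏ c, (classSize k m c).factorial := by
  have h := card_isSolution_and (k := k) (d := d) (m := m) x (fun _ => True)
  simp only [and_true] at h
  rw [h, Finset.sum_congr rfl (g := fun _ => ∏ c, (classSize k m c).factorial), Finset.sum_const,
    Finset.card_univ, smul_eq_mul, Nat.card_eq_fintype_card]
  intro τ _
  have := card_transports_extending (ι := Empty) hx τ (a := Empty.elim) (b := Empty.elim)
    (fun i => i.elim) (fun i => i.elim)
  simpa using this

theorem card_isSolution_extending_le {ι : Type*} [Fintype ι] {x : Fin n → Bool}
    (hx : Balanced k d m x) {a : ι → Fin n × Fin d} {b : ι → Fin m × Fin k}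
    (ha : a.Injective) (hb : b.Injective) :
    Nat.card {g : Config k d n m // IsSolution g x ∧ ∀ i, g (a i) = b i} *
        ∏ c, (classSize k m c).descFactorial (Nat.card {i // x (a i).1 = c}) ≤
      Nat.card {g : Config k d n m // IsSolution g x} := by
  classical
  rw [card_isSolution hx, card_isSolution_and, Finset.sum_mul, Nat.card_eq_fintype_card,
    ← smul_eq_mul, ← Finset.card_univ, ← Finset.sum_const]
  refine Finset.sum_le_sum fun τ _ => ?_
  rw [card_transports_extending hx τ ha hb]
  split_ifs <;> simp

/-- The number of ordered pairs of distinct half-edges at a constraint that take the values `b`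
and `b'`. -/
def pairCount (k : ℕ) (b b' : Bool) : ℕ := rowSize k b * (rowSize k b' - bif b == b' then 1 else 0)

theorem card_pairs_of_row (ρ : Fin k → Bool)
    (hρ : (Finset.univ.filter fun h => ρ h = true).card = 2) (b b' : Bool) :
    Nat.card {q : {q : Fin k × Fin k // q.1 ≠ q.2} // ρ q.1.1 = b ∧ ρ q.1.2 = b'} =
      pairCount k b b' := by
  have e : {q : {q : Fin k × Fin k // q.1 ≠ q.2} // ρ q.1.1 = b ∧ ρ q.1.2 = b'} ≃
      Σ h : {h // ρ h = b}, {h' // ρ h' = b' ∧ h.1 ≠ h'} :=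
    { toFun := fun q => ⟨⟨q.1.1.1, q.2.1⟩, q.1.1.2, q.2.2, q.1.2⟩
      invFun := fun w => ⟨⟨(w.1.1, w.2.1), w.2.2.2⟩, w.1.2, w.2.2.1⟩
      left_inv := fun _ => rfl
      right_inv := fun _ => rfl }
  rw [Nat.card_congr e, Nat.card_sigma]
  have h : ∀ h : {h // ρ h = b}, Nat.card {h' // ρ h' = b' ∧ h.1 ≠ h'} =
      rowSize k b' - bif b == b' then 1 else 0 := by
    rintro ⟨h, rfl⟩
    rw [Nat.subtype_card ((Finset.univ.filter fun h' => ρ h' = b').erase h)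
      (fun h' => by simp [and_comm, ne_comm]), Finset.card_erase_eq_ite, card_row ρ hρ]
    by_cases hb : ρ h = b'
    · simp [hb]
    · rw [beq_false_of_ne hb]
      simp [hb]
  rw [Finset.sum_congr rfl fun q _ => h q, Finset.sum_const, Finset.card_univ,
    Fintype.card_subtype, card_row ρ hρ, smul_eq_mul, pairCount]

end

/-! ### Counting configurations that contain prescribed vertex-disjoint cycles -/

section

variable {k d n m : ℕ} {P : Type*} (ρ : Equiv.Perm P)

/-- The data of vertex-disjoint directed cycles before a configuration is chosen: the set `P`
consists of the positions on the cycles, each of which carries a variable and a constraint, two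
half-edges of the variable (outgoing and incoming), and two half-edges of the constraint. -/
abbrev Placement (P : Type*) (k d n m : ℕ) : Type _ :=
  (P ↪ Fin n) × (P ↪ Fin m) × (P → {q : Fin d × Fin d // q.1 ≠ q.2}) ×
    (P → {q : Fin k × Fin k // q.1 ≠ q.2})

/-- The half-edges of the variables used by a placement, indexed by the constraint which they are to
be wired to. The permutation `ρ` sends a position to the next one on its cycle. -/
def Placement.vEdge (D : Placement P k d n m) : P ⊕ P → Fin n × Fin d :=
  Sum.elim (fun p => (D.1 p, (D.2.2.1 p).1.1)) (fun p => (D.1 (ρ p), (D.2.2.1 (ρ p)).1.2))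

/-- The half-edges of the constraints used by a placement. -/
def Placement.fEdge (D : Placement P k d n m) : P ⊕ P → Fin m × Fin k :=
  Sum.elim (fun p => (D.2.1 p, (D.2.2.2 p).1.1)) (fun p => (D.2.1 p, (D.2.2.2 p).1.2))

/-- The configuration `g` wires the half-edges as the placement requires. -/
def Placement.Realized (D : Placement P k d n m) (g : Config k d n m) : Prop :=
  ∀ z, g (D.vEdge ρ z) = D.fEdge z

theorem Placement.vEdge_injective (D : Placement P k d n m) : (D.vEdge ρ).Injective := by
  rintro (p | p) (q | q) h <;>
    simp only [vEdge, Sum.elim_inl, Sum.elim_inr, Prod.mk.injEq, EmbeddingLike.apply_eq_iff_eq] at h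
  · rw [h.1]
  · obtain ⟨rfl, h⟩ := h
    exact absurd h (D.2.2.1 _).2
  · obtain ⟨rfl, h⟩ := h
    exact absurd h.symm (D.2.2.1 _).2
  · rw [h.1]

theorem Placement.fEdge_injective (D : Placement P k d n m) : D.fEdge.Injective := by
  rintro (p | p) (q | q) h <;>
    simp only [fEdge, Sum.elim_inl, Sum.elim_inr, Prod.mk.injEq, EmbeddingLike.apply_eq_iff_eq] at h
  · rw [h.1]
  · obtain ⟨rfl, h⟩ := h
    exact absurd h (D.2.2.2 _).2
  · obtain ⟨rfl, h⟩ := h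
    exact absurd h.symm (D.2.2.2 _).2
  · rw [h.1]

theorem Placement.card_vEdge_class [Finite P] (D : Placement P k d n m) (x : Fin n → Bool)
    (b : Bool) :
    Nat.card {z // x (D.vEdge ρ z).1 = b} = 2 * Nat.card {p // x (D.1 p) = b} := by
  have e : {z // x (D.vEdge ρ z).1 = b} ≃ {p // x (D.1 p) = b} ⊕ {p // x (D.1 (ρ p)) = b} :=
    Equiv.subtypeSum
  rw [Nat.card_congr e, Nat.card_sum, two_mul]
  congr 1
  exact Nat.card_congr (ρ.subtypeEquiv fun p => Iff.rfl)

/-- The expected number of realized placements of `P` in a random configuration that is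
conditioned on having a given solution `x`, in terms of the numbers `N b` of variables of value `b`.
The summation variable `y` records the values of `x` along the cycles. -/
noncomputable def placementMean [Fintype P] [DecidableEq P] (ρ : Equiv.Perm P) (k d m : ℕ)
    (N : Bool → ℕ) : ℝ :=
  (m.descFactorial (Fintype.card P) : ℝ) * ((d : ℝ) * ((d : ℝ) - 1)) ^ Fintype.card P *
    ∑ y : P → Bool, (∏ b, ((N b).descFactorial (Nat.card {p // y p = b}) : ℝ)) *
      (∏ p, (pairCount k (y p) (y (ρ p)) : ℝ)) /
        ∏ b, ((classSize k m b).descFactorial (2 * Nat.card {p // y p = b}) : ℝ)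

theorem card_distinct_pairs (d : ℕ) :
    (Fintype.card {q : Fin d × Fin d // q.1 ≠ q.2} : ℝ) = (d : ℝ) * ((d : ℝ) - 1) := by
  rw [Fintype.card_subtype]
  have : (Finset.univ.filter fun q : Fin d × Fin d => q.1 ≠ q.2) =
      (Finset.univ : Finset (Fin d)).offDiag := by
    ext
    simp
  rw [this, Finset.offDiag_card, Finset.card_univ, Fintype.card_fin,
    Nat.cast_sub (Nat.le_mul_self d)]
  push_cast
  ring

/-- The identity is exact because the number of pairs of half-edges with given values does not
depend on the pattern, so that the sum over patterns decouples from the sum over placements. -/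
theorem sum_card_realized [Fintype P] [DecidableEq P] {x : Fin n → Bool} (hx : Balanced k d m x) :
    ∑ D : Placement P k d n m,
        (Nat.card {g : Config k d n m // IsSolution g x ∧ D.Realized ρ g} : ℝ) =
      Nat.card {g : Config k d n m // IsSolution g x} *
        placementMean ρ k d m (fun b => Nat.card {i // x i = b}) := by
  classical
  set F : ℝ := ∏ b, ((classSize k m b).factorial : ℝ) with hF
  have hF0 : F ≠ 0 := Finset.prod_ne_zero_iff.mpr fun b _ => by positivity
  -- the weight of a placement depends only on the values `y` of `x` along the cycles
  let G : (P → Bool) → ℝ := fun y =>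
    F / ∏ b, ((classSize k m b).descFactorial (2 * Nat.card {p // y p = b}) : ℝ)
  have hcount : ∀ D : Placement P k d n m,
      (Nat.card {g : Config k d n m // IsSolution g x ∧ D.Realized ρ g} : ℝ) =
        ∑ τ : Pattern k m,
          if ∀ p, (τ (D.2.1 p)).1 (D.2.2.2 p).1.1 = x (D.1 p) ∧
            (τ (D.2.1 p)).1 (D.2.2.2 p).1.2 = x (D.1 (ρ p)) then G (fun p => x (D.1 p)) else 0 := by
    intro D
    rw [card_isSolution_and, Nat.cast_sum]
    refine Finset.sum_congr rfl fun τ _ => ?_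
    have h := card_transports_extending hx τ (D.vEdge_injective ρ) D.fEdge_injective
    simp only [D.card_vEdge_class ρ x] at h
    have hiff : (∀ z, (τ (D.fEdge z).1).1 (D.fEdge z).2 = x (D.vEdge ρ z).1) ↔
        ∀ p, (τ (D.2.1 p)).1 (D.2.2.2 p).1.1 = x (D.1 p) ∧
          (τ (D.2.1 p)).1 (D.2.2.2 p).1.2 = x (D.1 (ρ p)) := by
      rw [Sum.forall, ← forall_and]
      rfl
    have h' := congrArg (Nat.cast : ℕ → ℝ) h
    rw [Nat.cast_mul, Nat.cast_prod] at h'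
    by_cases hc : ∀ p, (τ (D.2.1 p)).1 (D.2.2.2 p).1.1 = x (D.1 p) ∧
          (τ (D.2.1 p)).1 (D.2.2.2 p).1.2 = x (D.1 (ρ p))
    · rw [if_pos (hiff.mpr hc), Nat.cast_prod, ← hF] at h'
      rw [if_pos hc]
      exact eq_div_of_mul_eq (fun h0 => hF0 (by rw [← h', h0, mul_zero])) h'
    · rw [if_neg hc]
      have : IsEmpty {g : Config k d n m // Transports τ x g ∧ D.Realized ρ g} := by
        refine ⟨fun g => hc (hiff.mp fun z => ?_)⟩
        have := g.2.1 (D.vEdge ρ z)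
        rwa [g.2.2 z] at this
      rw [Nat.card_of_isEmpty, Nat.cast_zero]
  have hpairs : ∀ (v : P ↪ Fin n) (c : P ↪ Fin m) (τ : Pattern k m),
      (∑ h : P → {q : Fin k × Fin k // q.1 ≠ q.2},
        if ∀ p, (τ (c p)).1 (h p).1.1 = x (v p) ∧ (τ (c p)).1 (h p).1.2 = x (v (ρ p))
          then G (fun p => x (v p)) else 0) =
        (∏ p, (pairCount k (x (v p)) (x (v (ρ p))) : ℝ)) * G (fun p => x (v p)) := by
    intro v c τ
    let R : P → {q : Fin k × Fin k // q.1 ≠ q.2} → Prop := fun p q =>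
      (τ (c p)).1 q.1.1 = x (v p) ∧ (τ (c p)).1 q.1.2 = x (v (ρ p))
    have e : {h : P → {q : Fin k × Fin k // q.1 ≠ q.2} // ∀ p, R p (h p)} ≃ ∀ p, {q // R p q} :=
      Equiv.subtypePiEquivPi
    rw [← Finset.sum_filter, Finset.sum_const, nsmul_eq_mul, ← Fintype.card_subtype,
      ← Nat.card_eq_fintype_card, Nat.card_congr e, Nat.card_pi,
      Finset.prod_congr rfl fun p _ => card_pairs_of_row _ (τ (c p)).2 _ _, Nat.cast_prod]
  have hvalues : ∀ Φ : (P → Bool) → ℝ, ∑ v : P ↪ Fin n, Φ (fun p => x (v p)) = ∑ y,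
      (∏ b, ((Nat.card {i // x i = b}).descFactorial (Nat.card {p // y p = b}) : ℝ)) * Φ y := by
    intro Φ
    rw [← Finset.sum_fiberwise _ (fun v : P ↪ Fin n => fun p => x (v p))]
    refine Finset.sum_congr rfl fun y _ => ?_
    rw [Finset.sum_congr rfl (g := fun _ => Φ y), Finset.sum_const, nsmul_eq_mul,
      ← Nat.cast_prod, ← card_embedding_comp_eq, Nat.subtype_card]
    · intro v
      simp [funext_iff]
    · intro v hv
      rw [(Finset.mem_filter.mp hv).2]
  calc _ = ∑ v : P ↪ Fin n, ∑ _c : P ↪ Fin m, ∑ _o : P → {q : Fin d × Fin d // q.1 ≠ q.2},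
        ∑ _τ : Pattern k m,
          (∏ p, (pairCount k (x (v p)) (x (v (ρ p))) : ℝ)) * G (fun p => x (v p)) := by
        rw [Finset.sum_congr rfl fun D _ => hcount D]
        simp only [Fintype.sum_prod_type]
        refine Finset.sum_congr rfl fun v _ => Finset.sum_congr rfl fun c _ =>
          Finset.sum_congr rfl fun o _ => ?_
        rw [Finset.sum_comm]
        exact Finset.sum_congr rfl fun τ _ => hpairs v c τ
    _ = (m.descFactorial (Fintype.card P) : ℝ) * ((d : ℝ) * ((d : ℝ) - 1)) ^ Fintype.card P *
        (Nat.card (Pattern k m) * ∑ v : P ↪ Fin n,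
          (∏ p, (pairCount k (x (v p)) (x (v (ρ p))) : ℝ)) * G (fun p => x (v p))) := by
        simp only [Finset.sum_const, Finset.card_univ, nsmul_eq_mul, ← Finset.mul_sum]
        rw [Fintype.card_fun, Nat.cast_pow, card_distinct_pairs, Fintype.card_embedding_eq,
          Fintype.card_fin, Nat.card_eq_fintype_card]
        ring
    _ = _ := by
        rw [hvalues (fun y => (∏ p, (pairCount k (y p) (y (ρ p)) : ℝ)) * G y), card_isSolution hx,
          placementMean, Nat.cast_mul, Nat.cast_prod, ← hF]
        have : ∀ y : P → Bool, (∏ b, ((Nat.card {i // x i = b}).descFactorial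
            (Nat.card {p // y p = b}) : ℝ)) * ((∏ p, (pairCount k (y p) (y (ρ p)) : ℝ)) * G y) =
            F * ((∏ b, ((Nat.card {i // x i = b}).descFactorial (Nat.card {p // y p = b}) : ℝ)) *
      (∏ p, (pairCount k (y p) (y (ρ p)) : ℝ)) /
        ∏ b, ((classSize k m b).descFactorial (2 * Nat.card {p // y p = b}) : ℝ)) := by
          intro y
          simp only [G]
          ring
        rw [Finset.sum_congr rfl fun y _ => this y, ← Finset.mul_sum]
        ring

end

/-! ### Families of directed cycles -/

/-- The positions on a family of cycles with lengths `2 * len i`. -/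
abbrev Pos {I : Type*} (len : I → ℕ) : Type _ := Σ i, Fin (len i)

/-- The permutation which sends each position to the next one on its cycle. -/
def nextPos {I : Type*} (len : I → ℕ) : Equiv.Perm (Pos len) :=
  Equiv.sigmaCongrRight fun i => finRotate (len i)

/-- A family of directed cycles in `g` of lengths `2 * len i`. -/
abbrev Family {k d n m : ℕ} {I : Type*} (g : Config k d n m) (len : I → ℕ) : Type _ :=
  ∀ i, DirectedCycle g (len i)

namespace Family

variable {k d n m : ℕ} {I : Type*} {g : Config k d n m} {len : I → ℕ}

/-- The variable at a position. -/
def var (γ : Family g len) (p : Pos len) : Fin n := (γ p.1).var p.2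

/-- The constraint at a position. -/
def con (γ : Family g len) (p : Pos len) : Fin m := (γ p.1).con p.2

/-- No two positions share a variable or a constraint. -/
def VertexDisjoint (γ : Family g len) : Prop := γ.var.Injective ∧ γ.con.Injective

/-- The underlying undirected cycles are pairwise distinct. -/
def Distinct (γ : Family g len) : Prop := Function.Injective fun i => (γ i).edges

theorem VertexDisjoint.distinct (hlen : ∀ i, 0 < len i) {γ : Family g len}
    (h : γ.VertexDisjoint) : γ.Distinct := by
  intro i i' hi
  have hm := (γ i).out_mem ⟨0, hlen i⟩
  replace hi : (γ i).edges = (γ i').edges := hi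
  rw [hi] at hm
  obtain ⟨j, hj⟩ := hm
  have hv : γ.var ⟨i, ⟨0, hlen i⟩⟩ = γ.var ⟨i', j⟩ := by
    rcases hj with hj | hj <;> exact (Prod.mk.inj hj).1
  exact congrArg Sigma.fst (h.1 hv)

/-- Vertex-disjoint families of directed cycles in `g` are the placements that `g` realizes. -/
theorem card_vertexDisjoint (g : Config k d n m) (len : I → ℕ) :
    Nat.card {γ : Family g len // γ.VertexDisjoint} =
      Nat.card {D : Placement (Pos len) k d n m // D.Realized (nextPos len) g} := by
  symm
  refine Nat.card_eq_of_bijective (fun D => ⟨fun i =>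
    { var := fun j => D.1.1 ⟨i, j⟩
      con := fun j => D.1.2.1 ⟨i, j⟩
      out := fun j => (D.1.2.2.1 ⟨i, j⟩).1.1
      inc := fun j => (D.1.2.2.1 ⟨i, j⟩).1.2
      var_injective := fun j j' h => by simpa using h
      con_injective := fun j j' h => by simpa using h
      out_ne_inc := fun j => (D.1.2.2.1 ⟨i, j⟩).2
      out_wired := fun j => congrArg Prod.fst (D.2 (Sum.inl ⟨i, j⟩))
      inc_wired := fun j => congrArg Prod.fst (D.2 (Sum.inr ⟨i, j⟩)) },
    fun p q h => D.1.1.injective h, fun p q h => D.1.2.1.injective h⟩) ⟨?_, ?_⟩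
  · rintro ⟨⟨v, c, o, h⟩, hD⟩ ⟨⟨v', c', o', h'⟩, hD'⟩ he
    have he' := fun i => congrFun (congrArg Subtype.val he) i
    have hvar := fun i => congrArg DirectedCycle.var (he' i)
    have hcon := fun i => congrArg DirectedCycle.con (he' i)
    have hout := fun i => congrArg DirectedCycle.out (he' i)
    have hinc := fun i => congrArg DirectedCycle.inc (he' i)
    obtain rfl : v = v' := by
      ext1 ⟨i, j⟩
      exact congrFun (hvar i) j
    obtain rfl : c = c' := by
      ext1 ⟨i, j⟩
      exact congrFun (hcon i) j
    obtain rfl : o = o' := by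
      funext ⟨i, j⟩
      exact Subtype.ext (Prod.ext (congrFun (hout i) j) (congrFun (hinc i) j))
    obtain rfl : h = h' := by
      funext p
      refine Subtype.ext (Prod.ext ?_ ?_)
      · have := congrArg Prod.snd ((hD (Sum.inl p)).symm.trans (hD' (Sum.inl p)))
        exact this
      · have := congrArg Prod.snd ((hD (Sum.inr p)).symm.trans (hD' (Sum.inr p)))
        exact this
    rfl
  · rintro ⟨γ, hv, hc⟩
    have hne : ∀ p : Pos len, (g ((γ p.1).var p.2, (γ p.1).out p.2)).2 ≠
        (g ((γ p.1).var (finRotate _ p.2), (γ p.1).inc (finRotate _ p.2))).2 := by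
      intro p h
      refine (γ p.1).out_edge_ne_inc_edge p.2 (g.injective (Prod.ext ?_ h))
      rw [(γ p.1).out_wired, (γ p.1).inc_wired]
    refine ⟨⟨(⟨γ.var, hv⟩, ⟨γ.con, hc⟩,
      fun p => ⟨((γ p.1).out p.2, (γ p.1).inc p.2), (γ p.1).out_ne_inc p.2⟩,
      fun p => ⟨((g ((γ p.1).var p.2, (γ p.1).out p.2)).2,
        (g ((γ p.1).var (finRotate _ p.2), (γ p.1).inc (finRotate _ p.2))).2), hne p⟩), ?_⟩, rfl⟩
    rintro (p | p)
    · exact Prod.ext ((γ p.1).out_wired p.2) rfl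
    · exact Prod.ext ((γ p.1).inc_wired p.2) rfl

/-! ### Distinct cycles that meet span more edges than vertices -/

/-- The edges of a family, indexed by positions; see `DirectedCycle.edge`. -/
def edge (γ : Family g len) (q : Pos len × Bool) : Fin n × Fin d := (γ q.1.1).edge (q.1.2, q.2)

theorem edge_mem (γ : Family g len) (q : Pos len × Bool) : γ.edge q ∈ (γ q.1.1).edges := by
  rw [← DirectedCycle.range_edge]
  exact Set.mem_range_self _

theorem exists_edge_eq (γ : Family g len) {i : I} {e : Fin n × Fin d} (he : e ∈ (γ i).edges) :
    ∃ q, γ.edge q = e := by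
  rw [← DirectedCycle.range_edge] at he
  obtain ⟨⟨j, b⟩, rfl⟩ := he
  exact ⟨(⟨i, j⟩, b), rfl⟩

end Family

theorem finRotate_induction {ℓ : ℕ} {s : Fin ℓ → Prop} {j₀ : Fin ℓ} (h₀ : s j₀)
    (hs : ∀ j, s j → s (finRotate ℓ j)) (j : Fin ℓ) : s j := by
  obtain ⟨t, rfl⟩ := Nat.exists_eq_succ_of_ne_zero (Fin.pos j₀).ne'
  have key : ∀ i : Fin (t + 1), s (j₀ + i) := by
    intro i
    induction i using Fin.induction with
    | zero => simpa using h₀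
    | succ i ih =>
      have := hs _ ih
      rwa [finRotate_apply, add_assoc, Fin.coeSucc_eq_succ] at this
  simpa using key (j - j₀)

namespace DirectedCycle

variable {k d n m : ℕ} {g : Config k d n m} {ℓ ℓ' : ℕ}

theorem exists_var_of_mem (γ : DirectedCycle g ℓ) {e : Fin n × Fin d} (he : e ∈ γ.edges) :
    ∃ j, e.1 = γ.var j := by
  obtain ⟨j, rfl | rfl⟩ := he <;> exact ⟨j, rfl⟩

theorem exists_con_of_mem (γ : DirectedCycle g ℓ) {e : Fin n × Fin d} (he : e ∈ γ.edges) :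
    ∃ j, (g e).1 = γ.con j := by
  obtain ⟨j, rfl | rfl⟩ := he
  · exact ⟨j, γ.out_wired j⟩
  · obtain ⟨j, rfl⟩ := (finRotate ℓ).surjective j
    exact ⟨j, γ.inc_wired j⟩

/-- If two cycles meet and no edge of the first leaves the second at a vertex of the second, then
the first is contained in the second. -/
theorem edges_subset_of_meet (γ : DirectedCycle g ℓ) (γ' : DirectedCycle g ℓ')
    (hvar : ∀ e ∈ γ.edges, (∃ j, e.1 = γ'.var j) → e ∈ γ'.edges)
    (hcon : ∀ e ∈ γ.edges, (∃ j, (g e).1 = γ'.con j) → e ∈ γ'.edges)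
    (hmeet : (∃ j j', γ.var j = γ'.var j') ∨ ∃ j j', γ.con j = γ'.con j') :
    γ.edges ⊆ γ'.edges := by
  obtain ⟨j₀, h₀⟩ : ∃ j, ∃ j', γ.var j = γ'.var j' := by
    rcases hmeet with h | ⟨j, j', h⟩
    · exact h
    · have := hcon _ (γ.out_mem j) ⟨j', by rw [γ.out_wired, h]⟩
      exact ⟨j, γ'.exists_var_of_mem this⟩
  have hall : ∀ j, ∃ j', γ.var j = γ'.var j' := by
    refine finRotate_induction h₀ fun j hj => ?_
    obtain ⟨i, hi⟩ := γ'.exists_con_of_mem (hvar _ (γ.out_mem j) hj)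
    rw [γ.out_wired] at hi
    have := hcon _ (γ.inc_mem (finRotate ℓ j)) ⟨i, by rw [γ.inc_wired, hi]⟩
    exact γ'.exists_var_of_mem this
  rintro e ⟨j, rfl | rfl⟩
  · exact hvar _ (γ.out_mem j) (hall j)
  · exact hvar _ (γ.inc_mem j) (hall j)

end DirectedCycle

/-- A finite set that projects onto `t` with fibres of at least two elements has at least `2 * #t`
elements, and in the case of equality each fibre is any pair it contains. -/
theorem two_mul_card_le_of_fibers {A B : Type*} [DecidableEq A] [DecidableEq B] (s : Finset A)
    (t : Finset B) (f : A → B) (hf : ∀ a ∈ s, f a ∈ t)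
    (h2 : ∀ b ∈ t, ∃ a ∈ s, ∃ a' ∈ s, a ≠ a' ∧ f a = b ∧ f a' = b) :
    2 * t.card ≤ s.card ∧ (s.card ≤ 2 * t.card → ∀ a ∈ s, ∀ a₁ ∈ s, ∀ a₂ ∈ s, a₁ ≠ a₂ →
      f a₁ = f a → f a₂ = f a → a = a₁ ∨ a = a₂) := by
  have hge : ∀ b ∈ t, 2 ≤ (s.filter fun a => f a = b).card := by
    intro b hb
    obtain ⟨a, ha, a', ha', hne, h, h'⟩ := h2 b hb
    exact Finset.one_lt_card.mpr ⟨a, by simp [ha, h], a', by simp [ha', h'], hne⟩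
  have hsum := Finset.card_eq_sum_card_fiberwise (f := f) (s := s) (t := t) hf
  have hle : ∑ b ∈ t, 2 ≤ ∑ b ∈ t, (s.filter fun a => f a = b).card := Finset.sum_le_sum hge
  rw [Finset.sum_const, smul_eq_mul, mul_comm] at hle
  refine ⟨by rw [hsum]; exact hle, fun hs a ha a₁ h₁ a₂ h₂ hne e₁ e₂ => ?_⟩
  have heq := (Finset.sum_eq_sum_iff_of_le hge).mp
    (by rw [← hsum, Finset.sum_const, smul_eq_mul, mul_comm]; rw [hsum] at hs ⊢; omega)
    (f a) (hf a ha)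
  have hsub : {a₁, a₂} ⊆ s.filter fun x => f x = f a := by
    intro x hx
    rcases Finset.mem_insert.mp hx with rfl | hx
    · simp [h₁, e₁]
    · rw [Finset.mem_singleton.mp hx]
      simp [h₂, e₂]
  have := Finset.eq_of_subset_of_card_le hsub (by rw [← heq, Finset.card_pair hne])
  have ha' : a ∈ s.filter fun x => f x = f a := by simp [ha]
  rw [← this] at ha'
  simpa using ha'

/-- In the union of the cycles each vertex has degree at least two. If it had no more edges than
vertices, then all degrees would be two, and cycles that meet would coincide. -/
theorem Family.card_var_add_card_con_lt {k d n m : ℕ} {I : Type*} [Fintype I]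
    {g : Config k d n m} {len : I → ℕ} (γ : Family g len) (hd : γ.Distinct)
    (hv : ¬γ.VertexDisjoint) :
    (Finset.univ.image γ.var).card + (Finset.univ.image γ.con).card <
      (Finset.univ.image γ.edge).card := by
  by_contra! hle
  set E := Finset.univ.image γ.edge with hE
  have hmem : ∀ {i} {e}, e ∈ (γ i).edges → e ∈ E := fun he => by
    obtain ⟨q, rfl⟩ := γ.exists_edge_eq he
    exact Finset.mem_image_of_mem _ (Finset.mem_univ _)
  have hex : ∀ e ∈ E, ∃ i, e ∈ (γ i).edges := by
    intro e he
    obtain ⟨q, -, rfl⟩ := Finset.mem_image.mp he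
    exact ⟨_, γ.edge_mem q⟩
  have h1 := two_mul_card_le_of_fibers E (Finset.univ.image γ.var) Prod.fst
    (fun e he => by
      obtain ⟨i, hi⟩ := hex e he
      obtain ⟨j, hj⟩ := (γ i).exists_var_of_mem hi
      exact Finset.mem_image.mpr ⟨⟨i, j⟩, Finset.mem_univ _, hj.symm⟩)
    (fun b hb => by
      obtain ⟨⟨i, j⟩, -, rfl⟩ := Finset.mem_image.mp hb
      exact ⟨_, hmem ((γ i).out_mem j), _, hmem ((γ i).inc_mem j),
        fun h => (γ i).out_ne_inc j (Prod.mk.inj h).2, rfl, rfl⟩)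
  have h2 := two_mul_card_le_of_fibers E (Finset.univ.image γ.con) (fun e => (g e).1)
    (fun e he => by
      obtain ⟨i, hi⟩ := hex e he
      obtain ⟨j, hj⟩ := (γ i).exists_con_of_mem hi
      exact Finset.mem_image.mpr ⟨⟨i, j⟩, Finset.mem_univ _, hj.symm⟩)
    (fun b hb => by
      obtain ⟨⟨i, j⟩, -, rfl⟩ := Finset.mem_image.mp hb
      exact ⟨_, hmem ((γ i).out_mem j), _, hmem ((γ i).inc_mem _),
        (γ i).out_edge_ne_inc_edge j, (γ i).out_wired j, (γ i).inc_wired j⟩)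
  have h1' := h1.2 (by omega)
  have h2' := h2.2 (by omega)
  have hvar : ∀ i, ∀ e ∈ E, (∃ j, e.1 = (γ i).var j) → e ∈ (γ i).edges := by
    rintro i e he ⟨j, hj⟩
    rcases h1' e he _ (hmem ((γ i).out_mem j)) _ (hmem ((γ i).inc_mem j))
      (fun h => (γ i).out_ne_inc j (Prod.mk.inj h).2) hj.symm hj.symm with h | h
    · rw [h]
      exact (γ i).out_mem j
    · rw [h]
      exact (γ i).inc_mem j
  have hcon : ∀ i, ∀ e ∈ E, (∃ j, (g e).1 = (γ i).con j) → e ∈ (γ i).edges := by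
    rintro i e he ⟨j, hj⟩
    rcases h2' e he _ (hmem ((γ i).out_mem j)) _ (hmem ((γ i).inc_mem _))
      ((γ i).out_edge_ne_inc_edge j) (by rw [(γ i).out_wired, hj])
      (by rw [(γ i).inc_wired, hj]) with h | h
    · rw [h]
      exact (γ i).out_mem j
    · rw [h]
      exact (γ i).inc_mem _
  have key : ∀ i i', ((∃ j j', (γ i).var j = (γ i').var j') ∨
      ∃ j j', (γ i).con j = (γ i').con j') → (γ i).edges ⊆ (γ i').edges := fun i i' h =>
    (γ i).edges_subset_of_meet (γ i') (fun e he => hvar i' e (hmem he))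
      (fun e he => hcon i' e (hmem he)) h
  have hsame : ∀ i i', ((∃ j j', (γ i).var j = (γ i').var j') ∨
      ∃ j j', (γ i).con j = (γ i').con j') → i = i' := fun i i' h =>
    hd ((key i i' h).antisymm (key i' i (h.imp
      (fun ⟨j, j', h⟩ => ⟨j', j, h.symm⟩) fun ⟨j, j', h⟩ => ⟨j', j, h.symm⟩)))
  refine hv ⟨?_, ?_⟩
  · rintro ⟨i, j⟩ ⟨i', j'⟩ h
    obtain rfl := hsame i i' (Or.inl ⟨j, j', h⟩)
    exact congrArg _ ((γ i).var_injective h)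
  · rintro ⟨i, j⟩ ⟨i', j'⟩ h
    obtain rfl := hsame i i' (Or.inr ⟨j, j', h⟩)
    exact congrArg _ ((γ i).con_injective h)

/-! ### Families that are not vertex-disjoint are negligible -/

/-- Summing `m ^ (-#(image v))` over all maps `v` into a set of size of order `m` gives a bounded
quantity: a map with an image of size `j` is determined by its kernel and by `j` values. -/
theorem sum_inv_pow_card_image_le (P : Type*) [Fintype P] [DecidableEq P] {N m A : ℕ} (hm : 0 < m)
    (hA : 1 ≤ A) (hN : N ≤ A * m) :
    ∑ v : P → Fin N, ((m : ℝ)⁻¹) ^ (Finset.univ.image v).card ≤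
      ((Fintype.card P : ℝ) * A) ^ Fintype.card P := by
  classical
  -- `π v` sends each point to a representative of its fibre under `v`
  let π : (P → Fin N) → (P → P) := fun v p => (Quotient.mk (Setoid.ker v) p).out
  have hπ : ∀ (v : P → Fin N) (p : P), v (π v p) = v p := fun v p =>
    Quotient.mk_out (s := Setoid.ker v) p
  have hπ' : ∀ (v : P → Fin N) (p q : P), v p = v q → π v p = π v q := fun v p q h => by
    have : (Quotient.mk (Setoid.ker v) p) = Quotient.mk (Setoid.ker v) q := Quotient.sound h
    simp only [π, this]
  have hcard : ∀ v, (Finset.univ.image v).card = (Finset.univ.image (π v)).card := by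
    intro v
    have : Finset.univ.image v = (Finset.univ.image (π v)).image v := by
      rw [Finset.image_image]
      congr 1
      funext p
      exact (hπ v p).symm
    rw [this]
    refine Finset.card_image_of_injOn fun a ha b hb hab => ?_
    obtain ⟨p, -, rfl⟩ := Finset.mem_image.mp ha
    obtain ⟨q, -, rfl⟩ := Finset.mem_image.mp hb
    have hab' : v (π v p) = v (π v q) := hab
    exact hπ' v p q (by rwa [hπ v, hπ v] at hab')
  have hfib : ∀ σ : P → P, ((Finset.univ.filter fun v => π v = σ).card : ℝ) ≤
      (N : ℝ) ^ (Finset.univ.image σ).card := by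
    intro σ
    have : Nat.card {v // π v = σ} ≤ Nat.card ({q // q ∈ Finset.univ.image σ} → Fin N) := by
      refine Nat.card_le_card_of_injective (fun v q => v.1 q.1) fun v w h => ?_
      refine Subtype.ext (funext fun p => ?_)
      have := congrFun h ⟨σ p, Finset.mem_image_of_mem _ (Finset.mem_univ p)⟩
      simp only at this
      rw [← hπ v.1 p, ← hπ w.1 p, v.2, w.2, this]
    rw [Nat.card_eq_fintype_card, Fintype.card_subtype, Nat.card_eq_fintype_card, Fintype.card_fun,
      Fintype.card_coe, Fintype.card_fin] at this
    exact_mod_cast this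
  have hm' : (0 : ℝ) < m := by exact_mod_cast hm
  have hA' : (1 : ℝ) ≤ A := by exact_mod_cast hA
  calc ∑ v : P → Fin N, ((m : ℝ)⁻¹) ^ (Finset.univ.image v).card
      = ∑ σ : P → P, ∑ v with π v = σ, ((m : ℝ)⁻¹) ^ (Finset.univ.image v).card :=
        (Finset.sum_fiberwise _ _ _).symm
    _ ≤ ∑ _σ : P → P, (A : ℝ) ^ Fintype.card P := by
        refine Finset.sum_le_sum fun σ _ => ?_
        rw [Finset.sum_congr rfl (g := fun _ => ((m : ℝ)⁻¹) ^ (Finset.univ.image σ).card),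
          Finset.sum_const, nsmul_eq_mul]
        · calc _ ≤ (N : ℝ) ^ (Finset.univ.image σ).card *
                ((m : ℝ)⁻¹) ^ (Finset.univ.image σ).card := by
                gcongr
                exact hfib σ
            _ = (N / m : ℝ) ^ (Finset.univ.image σ).card := by rw [← mul_pow, div_eq_mul_inv]
            _ ≤ (A : ℝ) ^ (Finset.univ.image σ).card := by
                gcongr
                rw [div_le_iff₀ hm']
                exact_mod_cast hN
            _ ≤ (A : ℝ) ^ Fintype.card P :=
                pow_le_pow_right₀ hA' (Finset.card_image_le.trans (by simp))
        · intro v hv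
          rw [hcard, (Finset.mem_filter.mp hv).2]
    _ = _ := by
        rw [Finset.sum_const, Finset.card_univ, Fintype.card_fun, nsmul_eq_mul, mul_pow]
        push_cast
        ring

theorem sum_card_comm {A B : Type*} [Fintype A] [Fintype B] (p : A → Prop) [DecidablePred p]
    (R : B → A → Prop) :
    ∑ a with p a, Nat.card {b // R b a} = ∑ b, Nat.card {a // p a ∧ R b a} := by
  classical
  simp_rw [Nat.card_eq_fintype_card, Fintype.card_subtype, Finset.card_filter, Finset.sum_filter]
  rw [Finset.sum_comm]
  refine Finset.sum_congr rfl fun a _ => ?_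
  by_cases h : p a <;> simp [h]

section

variable {k d n m : ℕ} {I : Type*} {len : I → ℕ}

/-- The vertices and the half-edges visited by a family of directed cycles. -/
def Family.trace {g : Config k d n m} (γ : Family g len) :
    (Pos len → Fin n) × (Pos len → Fin m) × (Pos len × Bool → Fin d) × (Pos len × Bool → Fin k) :=
  (γ.var, γ.con, fun q => (γ.edge q).2, fun q => (g (γ.edge q)).2)

theorem Family.edge_eq_of_trace_eq {g g' : Config k d n m} {γ : Family g len} {γ' : Family g' len}
    (h : γ.trace = γ'.trace) (q : Pos len × Bool) : γ.edge q = γ'.edge q := by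
  simp only [trace, Prod.mk.injEq] at h
  exact Prod.ext (congrFun h.1 q.1) (congrFun h.2.2.1 q)

theorem Family.con_edge {g : Config k d n m} (γ : Family g len) (p : Pos len) :
    (g (γ.edge (p, true))).1 = γ.con p ∧ (g (γ.edge (nextPos len p, false))).1 = γ.con p :=
  ⟨(γ p.1).out_wired p.2, (γ p.1).inc_wired p.2⟩

theorem Family.wired_eq_of_trace_eq {g g' : Config k d n m} {γ : Family g len}
    {γ' : Family g' len} (h : γ.trace = γ'.trace) (q : Pos len × Bool) :
    g (γ.edge q) = g' (γ'.edge q) := by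
  simp only [trace, Prod.mk.injEq] at h
  refine Prod.ext ?_ (congrFun h.2.2.2 q)
  obtain ⟨p, b⟩ := q
  cases b
  · obtain ⟨p, rfl⟩ := (nextPos len).surjective p
    rw [(γ.con_edge p).2, (γ'.con_edge p).2, h.2.1]
  · rw [(γ.con_edge p).1, (γ'.con_edge p).1, h.2.1]

theorem Family.trace_injective (g : Config k d n m) :
    (Family.trace : Family g len → _).Injective := by
  intro γ γ' h
  have he := Family.edge_eq_of_trace_eq h
  funext i
  refine DirectedCycle.ext_of_eq (funext fun j => ?_) (funext fun j => ?_) (funext fun j => ?_)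
  · exact congrArg Prod.fst (he (⟨i, j⟩, true))
  · exact congrArg Prod.snd (he (⟨i, j⟩, true))
  · exact congrArg Prod.snd (he (⟨i, j⟩, false))

theorem le_classSize (hk : 3 ≤ k) (b : Bool) : m ≤ classSize k m b := by
  refine Nat.le_mul_of_pos_right m ?_
  cases b <;> simp only [rowSize, cond_true, cond_false] <;> omega

/-- A random configuration with a given solution has prescribed values on a set of `e` half-edges
with probability `O(m ^ (-e))`. -/
theorem card_isSolution_agree_le (hk : 3 ≤ k) {x : Fin n → Bool} (hx : Balanced k d m x)
    (g₀ : Config k d n m) (E : Finset (Fin n × Fin d)) (hE : 2 * E.card ≤ m) :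
    (Nat.card {g : Config k d n m // IsSolution g x ∧ ∀ e : E, g e = g₀ e} : ℝ) *
      ((m : ℝ) / 2) ^ E.card ≤ Nat.card {g : Config k d n m // IsSolution g x} := by
  have h := card_isSolution_extending_le hx (a := fun e : E => e.1) (b := fun e : E => g₀ e.1)
    Subtype.val_injective (g₀.injective.comp Subtype.val_injective)
  have hsum : ∑ c, Nat.card {e : E // x e.1.1 = c} = E.card := by
    rw [← Nat.card_sigma, Nat.card_congr (Equiv.sigmaFiberEquiv fun e : E => x e.1.1)]
    simp
  have hdesc : ((m : ℝ) / 2) ^ E.card ≤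
      ((∏ c, (classSize k m c).descFactorial (Nat.card {e : E // x e.1.1 = c}) : ℕ) : ℝ) := by
    rw [← hsum, ← Finset.prod_pow_eq_pow_sum, Nat.cast_prod]
    refine Finset.prod_le_prod (fun _ _ => by positivity) fun c _ => ?_
    set t := Nat.card {e : E // x e.1.1 = c} with ht
    have htE : t ≤ E.card := by
      rw [← hsum]
      exact Finset.single_le_sum (f := fun c => Nat.card {e : E // x e.1.1 = c})
        (fun _ _ => Nat.zero_le _) (Finset.mem_univ c)
    have hK : m ≤ classSize k m c := le_classSize hk c
    -- each factor of the falling factorial is at least `m / 2`, since `t ≤ m / 2`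
    calc ((m : ℝ) / 2) ^ t ≤ ((classSize k m c + 1 - t : ℕ) : ℝ) ^ t := by
          gcongr
          rw [div_le_iff₀ two_pos]
          have : m ≤ (classSize k m c + 1 - t) * 2 := by omega
          exact_mod_cast this
      _ ≤ _ := by exact_mod_cast Nat.pow_sub_le_descFactorial _ _
  calc _ ≤ (Nat.card {g : Config k d n m // IsSolution g x ∧ ∀ e : E, g e = g₀ e} : ℝ) *
        ((∏ c, (classSize k m c).descFactorial (Nat.card {e : E // x e.1.1 = c}) : ℕ) : ℝ) := by
        gcongr
    _ ≤ _ := by exact_mod_cast h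

/-- The implied constant in the bound for families that are not vertex-disjoint. -/
noncomputable def overlapConst (P : Type*) [Fintype P] (k d : ℕ) : ℝ :=
  4 ^ Fintype.card P * (((Fintype.card P : ℝ) * k) ^ Fintype.card P *
    ((Fintype.card P : ℝ) ^ Fintype.card P * (d ^ (Fintype.card P * 2) * k ^ (Fintype.card P * 2))))

/-- All families with the same trace force the same edges, of which there are more than vertices. -/
theorem card_overlapping_with_trace_le [Fintype I] (hk : 3 ≤ k) {x : Fin n → Bool}
    (hx : Balanced k d m x)
    (hm : 0 < m) (hP : 4 * Fintype.card (Pos len) ≤ m)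
    (T : (Pos len → Fin n) × (Pos len → Fin m) × (Pos len × Bool → Fin d) ×
      (Pos len × Bool → Fin k)) :
    (Nat.card {g : Config k d n m // IsSolution g x ∧
        ∃ γ : Family g len, (γ.Distinct ∧ ¬γ.VertexDisjoint) ∧ γ.trace = T} : ℝ) ≤
      Nat.card {g : Config k d n m // IsSolution g x} *
        (4 ^ Fintype.card (Pos len) * (m : ℝ)⁻¹ * (((m : ℝ)⁻¹) ^ (Finset.univ.image T.1).card *
          ((m : ℝ)⁻¹) ^ (Finset.univ.image T.2.1).card)) := by
  classical
  have hm' : (0 : ℝ) < m := by exact_mod_cast hm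
  rcases isEmpty_or_nonempty {g : Config k d n m // IsSolution g x ∧
        ∃ γ : Family g len, (γ.Distinct ∧ ¬γ.VertexDisjoint) ∧ γ.trace = T}
    with h | ⟨g₀, -, γ₀, hγ, rfl⟩
  · rw [Nat.card_of_isEmpty, Nat.cast_zero]
    positivity
  set E := Finset.univ.image γ₀.edge with hE
  have hE2 : E.card ≤ 2 * Fintype.card (Pos len) := by
    refine Finset.card_image_le.trans ?_
    rw [Finset.card_univ, Fintype.card_prod, Fintype.card_bool, mul_comm]
  have hlt := γ₀.card_var_add_card_con_lt hγ.1 hγ.2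
  have hle : Nat.card {g : Config k d n m // IsSolution g x ∧
        ∃ γ : Family g len, (γ.Distinct ∧ ¬γ.VertexDisjoint) ∧ γ.trace = γ₀.trace} ≤
      Nat.card {g : Config k d n m // IsSolution g x ∧ ∀ e : E, g e = g₀ e} := by
    refine Nat.card_le_card_of_injective (fun g => ⟨g.1, g.2.1, ?_⟩)
      fun g g' h => Subtype.ext (Subtype.mk.inj h)
    rintro ⟨e, he⟩
    obtain ⟨q, -, rfl⟩ := Finset.mem_image.mp he
    obtain ⟨-, γ, -, hT⟩ := g.2
    have h1 := Family.wired_eq_of_trace_eq hT q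
    rwa [Family.edge_eq_of_trace_eq hT q] at h1
  have hbound := card_isSolution_agree_le hk hx g₀ E (by omega)
  rw [← le_div_iff₀ (by positivity), div_eq_mul_inv] at hbound
  refine (Nat.cast_le.mpr hle).trans (hbound.trans ?_)
  gcongr
  rw [← inv_pow, inv_div, div_eq_mul_inv, mul_pow]
  have h4 : (2 : ℝ) ^ E.card ≤ 4 ^ Fintype.card (Pos len) := by
    rw [show (4 : ℝ) = 2 ^ 2 by norm_num, ← pow_mul]
    exact pow_le_pow_right₀ one_le_two hE2
  rw [mul_assoc, ← pow_add, ← pow_succ']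
  gcongr ?_ * ?_
  exact pow_le_pow_of_le_one (by positivity) (inv_le_one_of_one_le₀ (by exact_mod_cast hm)) hlt

theorem sum_card_overlapping_le [Fintype I] (hk : 3 ≤ k) {x : Fin n → Bool} (hx : Balanced k d m x)
    (hm : 0 < m) (hnm : n ≤ k * m) (hP : 4 * Fintype.card (Pos len) ≤ m)
    [DecidablePred fun g : Config k d n m => IsSolution g x] :
    ∑ g : Config k d n m with IsSolution g x,
        (Nat.card {γ : Family g len // γ.Distinct ∧ ¬γ.VertexDisjoint} : ℝ) ≤
      Nat.card {g : Config k d n m // IsSolution g x} * (overlapConst (Pos len) k d / m) := by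
  classical
  have hle : ∀ g : Config k d n m,
      Nat.card {γ : Family g len // γ.Distinct ∧ ¬γ.VertexDisjoint} ≤
        Nat.card {T // ∃ γ : Family g len, (γ.Distinct ∧ ¬γ.VertexDisjoint) ∧ γ.trace = T} :=
    fun g => Nat.card_le_card_of_injective (fun γ => ⟨γ.1.trace, γ.1, γ.2, rfl⟩)
      fun γ γ' h => Subtype.ext (Family.trace_injective g (congrArg Subtype.val h))
  refine (Finset.sum_le_sum fun g _ => Nat.cast_le.mpr (hle g)).trans ?_
  rw [← Nat.cast_sum, sum_card_comm, Nat.cast_sum]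
  refine (Finset.sum_le_sum fun T _ => card_overlapping_with_trace_le hk hx hm hP T).trans ?_
  rw [← Finset.mul_sum, ← Finset.mul_sum]
  gcongr
  have hv := sum_inv_pow_card_image_le (Pos len) hm (by omega : 1 ≤ k) hnm
  have hc := sum_inv_pow_card_image_le (Pos len) hm le_rfl (one_mul m).ge
  rw [Nat.cast_one, mul_one] at hc
  have hsplit : ∑ T : (Pos len → Fin n) × (Pos len → Fin m) × (Pos len × Bool → Fin d) ×
        (Pos len × Bool → Fin k), (((m : ℝ)⁻¹) ^ (Finset.univ.image T.1).card *
          ((m : ℝ)⁻¹) ^ (Finset.univ.image T.2.1).card) =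
      (∑ v : Pos len → Fin n, ((m : ℝ)⁻¹) ^ (Finset.univ.image v).card) *
        ((∑ c : Pos len → Fin m, ((m : ℝ)⁻¹) ^ (Finset.univ.image c).card) *
          (d ^ (Fintype.card (Pos len) * 2) * k ^ (Fintype.card (Pos len) * 2))) := by
    simp only [Fintype.sum_prod_type, Finset.sum_const, Finset.card_univ, Fintype.card_fun,
      Fintype.card_prod, Fintype.card_bool, Fintype.card_fin, nsmul_eq_mul,
      ← Finset.mul_sum, ← Finset.sum_mul]
    push_cast
    ring
  rw [hsplit, overlapConst, div_eq_mul_inv, mul_right_comm]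
  gcongr

theorem sum_card_vertexDisjoint [Fintype I] [DecidableEq I] {x : Fin n → Bool}
    (hx : Balanced k d m x)
    [DecidablePred fun g : Config k d n m => IsSolution g x] :
    ∑ g : Config k d n m with IsSolution g x,
        (Nat.card {γ : Family g len // γ.VertexDisjoint} : ℝ) =
      Nat.card {g : Config k d n m // IsSolution g x} *
        placementMean (nextPos len) k d m (fun b => Nat.card {i // x i = b}) := by
  rw [← sum_card_realized _ hx, ← Nat.cast_sum, ← Nat.cast_sum,
    Finset.sum_congr rfl fun g _ => Family.card_vertexDisjoint g len, sum_card_comm]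

end

/-! ### Closed walks and traces -/

/-- Paths weighted by products of entries of `A`, sorted by their end points. -/
theorem sum_paths_eq_sum_pow {ι R : Type*} [Fintype ι] [DecidableEq ι] [CommRing R]
    (A : Matrix ι ι R) (s : ℕ) (Φ : ι → ι → R) :
    ∑ y : Fin (s + 1) → ι, (∏ j : Fin s, A (y j.castSucc) (y j.succ)) * Φ (y 0) (y (Fin.last s)) =
      ∑ a, ∑ b, (A ^ s) a b * Φ a b := by
  induction s generalizing Φ with
  | zero =>
    rw [← (Equiv.funUnique (Fin 1) ι).symm.sum_comp]
    simp [Matrix.one_apply]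
  | succ s ih =>
    rw [← (Fin.consEquiv fun _ => ι).sum_comp, Fintype.sum_prod_type]
    refine Finset.sum_congr rfl fun a _ => ?_
    have h := ih fun c b => A a c * Φ a b
    calc _ = ∑ z : Fin (s + 1) → ι, (∏ j : Fin s, A (z j.castSucc) (z j.succ)) *
          (A a (z 0) * Φ a (z (Fin.last s))) := by
          refine Finset.sum_congr rfl fun z _ => ?_
          simp only [Fin.consEquiv_apply]
          rw [Fin.prod_univ_succ]
          simp only [Fin.castSucc_zero, Fin.cons_zero, Fin.cons_succ, ← Fin.succ_castSucc,
            ← Fin.succ_last]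
          ring
      _ = _ := by
          rw [h, Finset.sum_comm]
          refine Finset.sum_congr rfl fun b _ => ?_
          rw [pow_succ', Matrix.mul_apply, Finset.sum_mul]
          exact Finset.sum_congr rfl fun c _ => by ring

theorem sum_closed_walks_eq_trace {ι R : Type*} [Fintype ι] [DecidableEq ι] [CommRing R]
    (A : Matrix ι ι R) {ℓ : ℕ} (hℓ : 0 < ℓ) :
    ∑ y : Fin ℓ → ι, ∏ j, A (y j) (y (finRotate ℓ j)) = (A ^ ℓ).trace := by
  obtain ⟨s, rfl⟩ := Nat.exists_eq_add_one.mpr hℓ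
  rw [pow_succ, Matrix.trace]
  simp only [Matrix.diag_apply, Matrix.mul_apply]
  rw [← sum_paths_eq_sum_pow A s fun a b => A b a]
  refine Finset.sum_congr rfl fun y _ => ?_
  rw [Fin.prod_univ_castSucc, finRotate_last]
  simp [finRotate_apply, Fin.coeSucc_eq_succ]

theorem sum_closed_walks_family {I ι R : Type*} [Fintype I] [DecidableEq I] [Fintype ι]
    [DecidableEq ι] [CommRing R] (A : Matrix ι ι R) {len : I → ℕ} (hlen : ∀ i, 0 < len i) :
    ∑ y : Pos len → ι, ∏ p, A (y p) (y (nextPos len p)) = ∏ i, (A ^ len i).trace := by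
  simp_rw [← sum_closed_walks_eq_trace A (hlen _)]
  rw [Finset.prod_univ_sum, Fintype.piFinset_univ,
    ← (Equiv.piCurry fun (i : I) (_ : Fin (len i)) => ι).sum_comp]
  refine Finset.sum_congr rfl fun y _ => ?_
  rw [Fintype.prod_sigma]
  rfl

/-- The matrix `1 rᵀ` has rank one, so that `1 rᵀ - 1` has the eigenvalue `∑ r - 1` once and `-1`
otherwise. -/
theorem trace_rank_one_sub_one_pow {ι : Type*} [Fintype ι] [DecidableEq ι] (A : Matrix ι ι ℝ)
    (r : ι → ℝ) (c K : ℝ) (hr : ∑ i, r i = K) (hK : K ≠ 0)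
    (hA : ∀ i j, A i j = c * (r j - if i = j then 1 else 0)) (ℓ : ℕ) :
    (A ^ ℓ).trace = c ^ ℓ * ((K - 1) ^ ℓ + (Fintype.card ι - 1) * (-1) ^ ℓ) := by
  have key : ∀ i j, (A ^ ℓ) i j =
      c ^ ℓ * (((K - 1) ^ ℓ - (-1) ^ ℓ) / K * r j + (-1) ^ ℓ * if i = j then 1 else 0) := by
    induction ℓ with
    | zero => simp [Matrix.one_apply]
    | succ s ih =>
      intro i j
      rw [pow_succ', Matrix.mul_apply]
      simp_rw [ih, hA]
      have hsplit : ∀ b, c * (r b - if i = b then 1 else 0) *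
          (c ^ s * (((K - 1) ^ s - (-1) ^ s) / K * r j + (-1) ^ s * if b = j then 1 else 0)) =
          c ^ (s + 1) * (((K - 1) ^ s - (-1) ^ s) / K * r j * r b
            + (-1) ^ s * (if b = j then r b else 0)
            - ((K - 1) ^ s - (-1) ^ s) / K * r j * (if i = b then 1 else 0)
            - (-1) ^ s * if i = b then (if b = j then 1 else 0) else 0) := by
        intro b
        split_ifs <;> ring
      simp_rw [hsplit]
      rw [← Finset.mul_sum, Finset.sum_sub_distrib, Finset.sum_sub_distrib, Finset.sum_add_distrib,
        ← Finset.mul_sum, ← Finset.mul_sum, ← Finset.mul_sum, ← Finset.mul_sum, hr]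
      simp only [Finset.sum_ite_eq, Finset.sum_ite_eq', Finset.mem_univ, if_true]
      field_simp
      ring
  simp only [Matrix.trace, Matrix.diag_apply, key, if_true, mul_one]
  rw [← Finset.mul_sum, Finset.sum_add_distrib, ← Finset.mul_sum, hr]
  simp only [Finset.sum_const, Finset.card_univ, nsmul_eq_mul]
  field_simp
  ring

theorem one_add_delta_mul_pow {k : ℕ} (hk : 1 < k) (ℓ : ℕ) (c : ℝ) :
    c ^ ℓ * (((k : ℝ) - 1) ^ ℓ + (-1) ^ ℓ) = (((k : ℝ) - 1) * c) ^ ℓ * (1 + delta k ℓ) := by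
  have : ((k : ℝ) - 1) ≠ 0 := by
    have : (1 : ℝ) < k := by exact_mod_cast hk
    linarith
  rw [delta, div_pow, mul_pow]
  field_simp

theorem one_add_delta_eq_trace {k : ℕ} (hk : 3 < k) (ℓ : ℕ) :
    1 + delta k ℓ = (transition k ^ ℓ).trace := by
  have hk' : (3 : ℝ) < k := by exact_mod_cast hk
  have h1 : (k : ℝ) - 1 ≠ 0 := by linarith
  rw [← Matrix.trace_transpose, Matrix.transpose_pow,
    trace_rank_one_sub_one_pow _ ![(k : ℝ) - 2, 2] ((k : ℝ) - 1)⁻¹ k (by simp) (by linarith)]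
  · have := one_add_delta_mul_pow (by omega : 1 < k) ℓ ((k : ℝ) - 1)⁻¹
    rw [mul_inv_cancel₀ h1, one_pow, one_mul] at this
    rw [← this]
    norm_num
  · intro i j
    fin_cases i <;> fin_cases j <;> simp [transition] <;> field_simp <;> ring

/-! ### The limit of the mean number of placements -/

/-- The limiting weight of a step from a variable of value `b` to one of value `b'`. -/
noncomputable def stepWeight (k d : ℕ) : Matrix Bool Bool ℝ :=
  Matrix.of fun b b' => ((d : ℝ) - 1) * ((rowSize k b' : ℝ) - if b = b' then 1 else 0)

theorem rowSize_pos {k : ℕ} (hk : 3 < k) (b : Bool) : 0 < rowSize k b := by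
  cases b <;> simp only [rowSize, cond_true, cond_false] <;> omega

theorem trace_stepWeight_pow {k : ℕ} (hk : 3 < k) (d ℓ : ℕ) :
    (stepWeight k d ^ ℓ).trace =
      (((k : ℝ) - 1) * ((d : ℝ) - 1)) ^ ℓ * (1 + delta k ℓ) := by
  have hk' : (3 : ℝ) < k := by exact_mod_cast hk
  rw [← one_add_delta_mul_pow (by omega),
    trace_rank_one_sub_one_pow (stepWeight k d) (fun b => (rowSize k b : ℝ))
    ((d : ℝ) - 1) k _ (by linarith) fun i j => rfl]
  · norm_num
  · rw [Fintype.sum_bool]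
    simp only [rowSize, cond_true, cond_false]
    rw [Nat.cast_sub (by omega)]
    push_cast
    ring

theorem stepWeight_eq {k : ℕ} (hk : 3 < k) (d : ℕ) (b b' : Bool) :
    stepWeight k d b b' = ((d : ℝ) - 1) / rowSize k b * pairCount k b b' := by
  have h : (rowSize k b : ℝ) ≠ 0 := by exact_mod_cast (rowSize_pos hk b).ne'
  have h' := rowSize_pos hk b'
  simp only [stepWeight, Matrix.of_apply, pairCount]
  rw [Nat.cast_mul, Nat.cast_sub (by cases b <;> cases b' <;> simp <;> omega)]
  cases b <;> cases b' <;> simp <;> field_simp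

theorem tendsto_descFactorial_div_pow {α : Type*} {l : Filter α} {u : α → ℕ}
    (hu : Tendsto u l atTop) (j : ℕ) :
    Tendsto (fun a => ((u a).descFactorial j : ℝ) / (u a : ℝ) ^ j) l (nhds 1) := by
  have h := (isEquivalent_descFactorial j).comp_tendsto hu
  refine (isEquivalent_iff_tendsto_one ?_).mp h
  filter_upwards [hu.eventually_gt_atTop 0] with a ha
  have : (0 : ℝ) < u a := by exact_mod_cast ha
  exact (pow_pos this j).ne'

theorem tendsto_placementMean {α P : Type*} [Fintype P] [DecidableEq P] (ρ : Equiv.Perm P)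
    {k d : ℕ} (hk : 3 < k) (hd : 1 < d) {l : Filter α} {m : α → ℕ} {N : α → Bool → ℕ}
    (hm : Tendsto m l atTop) (hN : ∀ᶠ a in l, ∀ b, d * N a b = classSize k (m a) b) :
    Tendsto (fun a => placementMean ρ k d (m a) (N a)) l
      (nhds (∑ y : P → Bool, ∏ p, stepWeight k d (y p) (y (ρ p)))) := by
  have hd' : (1 : ℝ) < d := by exact_mod_cast hd
  have hKle : ∀ a b, m a ≤ classSize k (m a) b := fun a b => le_classSize (by omega) b
  have hK : ∀ b, Tendsto (fun a => classSize k (m a) b) l atTop := fun b =>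
    tendsto_atTop_mono (fun a => hKle a b) hm
  have hN' : ∀ b, Tendsto (fun a => N a b) l atTop := by
    intro b
    refine tendsto_atTop.mpr fun c => ?_
    filter_upwards [hN, hm.eventually_ge_atTop (d * c)] with a ha hma
    have := hKle a b
    rw [← ha b] at this
    exact Nat.le_of_mul_le_mul_left (hma.trans this) (by omega)
  have hcard : ∀ y : P → Bool, ∑ b, Nat.card {p // y p = b} = Fintype.card P := by
    intro y
    rw [← Nat.card_sigma, Nat.card_congr (Equiv.sigmaFiberEquiv y), Nat.card_eq_fintype_card]
  unfold placementMean
  simp_rw [Finset.mul_sum]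
  refine tendsto_finsetSum _ fun y _ => ?_
  -- all falling factorials are replaced by powers, whose quotient does not depend on `a`
  have hlim := (((tendsto_descFactorial_div_pow hm (Fintype.card P)).mul
    (tendsto_finsetProd Finset.univ fun b _ =>
      tendsto_descFactorial_div_pow (hN' b) (Nat.card {p // y p = b}))).div
    (tendsto_finsetProd Finset.univ fun b _ =>
      tendsto_descFactorial_div_pow (hK b) (2 * Nat.card {p // y p = b})) (by simp)).mul_const
    (∏ p, stepWeight k d (y p) (y (ρ p)))
  simp only [Finset.prod_const_one, mul_one, div_one, one_mul] at hlim
  refine hlim.congr' ?_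
  filter_upwards [hN, hm.eventually_gt_atTop 0] with a ha hma
  have hm0 : (m a : ℝ) ≠ 0 := by exact_mod_cast hma.ne'
  have hd0 : (d : ℝ) ≠ 0 := by linarith
  have hr0 : ∀ b, (rowSize k b : ℝ) ≠ 0 := fun b => by exact_mod_cast (rowSize_pos hk b).ne'
  have hKr : ∀ b, (classSize k (m a) b : ℝ) = m a * rowSize k b := fun b => by
    rw [classSize, Nat.cast_mul]
  have hNr : ∀ b, (N a b : ℝ) = m a * rowSize k b / d := fun b => by
    rw [eq_div_iff hd0, ← hKr, ← ha b, Nat.cast_mul, mul_comm]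
  have hprod : ∏ p, stepWeight k d (y p) (y (ρ p)) =
      (∏ b, (((d : ℝ) - 1) / rowSize k b) ^ Nat.card {p // y p = b}) *
        ∏ p, (pairCount k (y p) (y (ρ p)) : ℝ) := by
    simp_rw [stepWeight_eq hk]
    rw [Finset.prod_mul_distrib]
    congr 1
    rw [← Finset.prod_fiberwise _ y]
    refine Finset.prod_congr rfl fun b _ => ?_
    rw [Finset.prod_congr rfl (g := fun _ => ((d : ℝ) - 1) / rowSize k b), Finset.prod_const,
      Nat.card_eq_fintype_card, Fintype.card_subtype]
    intro p hp
    rw [(Finset.mem_filter.mp hp).2]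
  rw [hprod, ← hcard y]
  simp only [Pi.div_apply, Fintype.prod_bool, Fintype.sum_bool, hKr, hNr]
  -- the exponents of `m a` cancel: a step contributes one variable, one constraint and two edges
  have hpow : ∀ (b : Bool) (s : ℕ), (((d : ℝ) - 1) / rowSize k b) ^ s *
      ((m a * rowSize k b : ℝ) ^ (2 * s)) / ((m a : ℝ) ^ s * (m a * rowSize k b / d : ℝ) ^ s) =
      ((d : ℝ) * ((d : ℝ) - 1)) ^ s := by
    intro b s
    have := hr0 b
    rw [pow_mul, ← mul_pow, ← mul_pow, ← div_pow]
    congr 1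
    field_simp
  rw [pow_add, pow_add, ← hpow true (Nat.card {p // y p = true}),
    ← hpow false (Nat.card {p // y p = false})]
  simp only [div_eq_mul_inv, mul_inv, inv_inv]
  ring

/-! ### The limit of the planted moments -/

theorem exists_classes_of_admissible {k d n : ℕ} (hk : 3 < k)
    (hn : n ∈ admissible k d) :
    k * (d * n / k) = d * n ∧ ∃ w ≤ n, d * w = classSize k (d * n / k) true ∧
      d * (n - w) = classSize k (d * n / k) false := by
  obtain ⟨h0, h1, w, hw⟩ := hn
  have hm : k * (d * n / k) = d * n := Nat.mul_div_cancel' h1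
  set m := d * n / k
  have hwn : w ≤ n := by nlinarith
  have htrue : d * w = m * 2 := by
    have : k * (d * w) = k * (m * 2) := by
      rw [Nat.mul_left_comm, ← hw, ← mul_assoc k, hm]
      ring
    exact Nat.eq_of_mul_eq_mul_left (by omega) this
  refine ⟨hm, w, hwn, htrue, ?_⟩
  simp only [classSize, rowSize, cond_false]
  rw [Nat.mul_sub, Nat.mul_sub, htrue, ← hm, mul_comm k]

theorem exists_balanced {k d n : ℕ} (hk : 3 < k) (hn : n ∈ admissible k d) :
    ∃ x : Fin n → Bool, Balanced k d (d * n / k) x := by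
  obtain ⟨-, w, hwn, h1, h2⟩ := exists_classes_of_admissible hk hn
  have htrue : Nat.card {i : Fin n // decide ((i : ℕ) < w) = true} = w := by
    simp only [decide_eq_true_eq]
    rw [Nat.card_congr (Fin.castLEquiv hwn).symm]
    simp
  have hsum : ∑ b, Nat.card {i : Fin n // decide ((i : ℕ) < w) = b} = n := by
    rw [← Nat.card_sigma,
      Nat.card_congr (Equiv.sigmaFiberEquiv fun i : Fin n => decide ((i : ℕ) < w)),
      Nat.card_eq_fintype_card, Fintype.card_fin]
  rw [Fintype.sum_bool, htrue] at hsum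
  refine ⟨fun i => decide ((i : ℕ) < w), fun b => ?_⟩
  cases b
  · rw [← h2, Nat.sub_eq_of_eq_add' hsum.symm]
  · rw [htrue, h1]

theorem card_isSolution_pos {k d n m : ℕ} (hk : 3 < k) {x : Fin n → Bool}
    (hx : Balanced k d m x) : 0 < Nat.card {g : Config k d n m // IsSolution g x} := by
  rw [card_isSolution hx]
  have hrow : ∃ ρ : Fin k → Bool, (Finset.univ.filter fun h => ρ h = true).card = 2 := by
    obtain ⟨s, -, hs⟩ := Finset.exists_subset_card_eq (s := (Finset.univ : Finset (Fin k))) (n := 2)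
      (by simp; omega)
    exact ⟨fun h => decide (h ∈ s), by simpa using hs⟩
  obtain ⟨ρ, hρ⟩ := hrow
  have : Nonempty (Pattern k m) := ⟨fun _ => ⟨ρ, hρ⟩⟩
  exact Nat.mul_pos Nat.card_pos (Finset.prod_pos fun b _ => Nat.factorial_pos _)

section

variable {k d n m : ℕ} {I : Type*} [Fintype I] {len : I → ℕ}

/-- The number of families of directed cycles whose underlying undirected cycles are distinct. -/
noncomputable def numFamilies (len : I → ℕ) (g : Config k d n m) : ℕ :=
  Nat.card {γ : Family g len // γ.Distinct}

theorem numFamilies_eq (hlen : ∀ i, 0 < len i) (g : Config k d n m) :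
    numFamilies len g = Nat.card {γ : Family g len // γ.VertexDisjoint} +
      Nat.card {γ : Family g len // γ.Distinct ∧ ¬γ.VertexDisjoint} := by
  classical
  rw [numFamilies, ← Nat.card_sum]
  refine Nat.card_congr ((Equiv.sumCompl fun γ : {γ : Family g len // γ.Distinct} =>
    γ.1.VertexDisjoint).symm.trans (Equiv.sumCongr ?_ ?_))
  · exact (Equiv.subtypeSubtypeEquivSubtypeInter _ _).trans
      (Equiv.subtypeEquivRight fun γ => ⟨fun h => h.2, fun h => ⟨h.distinct hlen, h⟩⟩)
  · exact Equiv.subtypeSubtypeEquivSubtypeInter Family.Distinct fun γ => ¬γ.VertexDisjoint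

theorem sum_numSolutions_mul (F : Config k d n m → ℝ)
    [∀ x : Fin n → Bool, DecidablePred fun g : Config k d n m => IsSolution g x] :
    ∑ g : Config k d n m, (numSolutions g : ℝ) * F g =
      ∑ x : Fin n → Bool, ∑ g : Config k d n m with IsSolution g x, F g := by
  classical
  simp_rw [Finset.sum_filter]
  rw [Finset.sum_comm]
  refine Finset.sum_congr rfl fun g _ => ?_
  rw [← Finset.sum_filter, Finset.sum_const, nsmul_eq_mul, numSolutions,
    Set.ncard_eq_toFinset_card']
  congr 2
  congr 1
  ext x
  simp

/-- Given any solution, the mean number of families of distinct cycles is the mean number of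
vertex-disjoint ones, up to an error of order `1 / m`. -/
theorem sum_numFamilies_bounds [DecidableEq I] (hlen : ∀ i, 0 < len i) (hk : 3 < k) (hd : 1 < d)
    {N : Bool → ℕ} (hN : ∀ b, d * N b = classSize k m b) (hm : 0 < m) (hnm : n ≤ k * m)
    (hP : 4 * Fintype.card (Pos len) ≤ m) (x : Fin n → Bool)
    [DecidablePred fun g : Config k d n m => IsSolution g x] :
    Nat.card {g : Config k d n m // IsSolution g x} * placementMean (nextPos len) k d m N ≤
        ∑ g : Config k d n m with IsSolution g x, (numFamilies len g : ℝ) ∧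
      ∑ g : Config k d n m with IsSolution g x, (numFamilies len g : ℝ) ≤
        Nat.card {g : Config k d n m // IsSolution g x} *
          (placementMean (nextPos len) k d m N + overlapConst (Pos len) k d / m) := by
  by_cases hx : Balanced k d m x
  · obtain rfl : N = fun b => Nat.card {i // x i = b} := by
      funext b
      exact Nat.eq_of_mul_eq_mul_left (by omega) ((hN b).trans (hx b).symm)
    simp_rw [numFamilies_eq hlen, Nat.cast_add]
    rw [Finset.sum_add_distrib, sum_card_vertexDisjoint hx, mul_add]
    exact ⟨le_add_of_nonneg_right (Finset.sum_nonneg fun _ _ => Nat.cast_nonneg _),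
      add_le_add_right (sum_card_overlapping_le (by omega) hx hm hnm hP) _⟩
  · have h : ∀ g : Config k d n m, ¬IsSolution g x := fun g hg => hx hg.balanced
    simp [h]

end

theorem tendsto_expect_numFamilies {I : Type*} [Fintype I] [DecidableEq I] {len : I → ℕ}
    (hlen : ∀ i, 0 < len i) {k d : ℕ} (hk : 3 < k) (hd : 1 < d) :
    Tendsto (fun n : ℕ =>
      expect (fun g : Config k d n (d * n / k) => (numSolutions g : ℝ) * (numFamilies len g : ℝ)) /
        expect (fun g : Config k d n (d * n / k) => (numSolutions g : ℝ)))
      (atTop ⊓ 𝓟 (admissible k d))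
      (nhds (∏ i, ((((k : ℝ) - 1) * ((d : ℝ) - 1)) ^ len i * (1 + delta k (len i))))) := by
  classical
  have hm : Tendsto (fun n => d * n / k) (atTop ⊓ 𝓟 (admissible k d)) atTop := by
    refine Tendsto.mono_left ?_ inf_le_left
    refine tendsto_atTop.mpr fun c => ?_
    filter_upwards [eventually_ge_atTop (c * k)] with n hn
    rw [Nat.le_div_iff_mul_le (by omega)]
    nlinarith
  have hadm : ∀ᶠ n in atTop ⊓ 𝓟 (admissible k d), n ∈ admissible k d :=
    mem_inf_of_right (mem_principal_self _)
  have hN : ∀ n ∈ admissible k d, ∀ b,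
      d * (classSize k (d * n / k) b / d) = classSize k (d * n / k) b := by
    intro n hn b
    obtain ⟨-, w, -, h1, h2⟩ := exists_classes_of_admissible hk hn
    apply Nat.mul_div_cancel'
    cases b
    · exact ⟨_, h2.symm⟩
    · exact ⟨_, h1.symm⟩
  have hmean := tendsto_placementMean (nextPos len) hk hd hm (hadm.mono hN)
  rw [sum_closed_walks_family _ hlen] at hmean
  simp_rw [trace_stepWeight_pow hk] at hmean
  have herr := hmean.add ((tendsto_natCast_atTop_atTop.comp hm).const_div_atTop
    (overlapConst (Pos len) k d))
  rw [add_zero] at herr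
  have key : ∀ᶠ n in atTop ⊓ 𝓟 (admissible k d),
      placementMean (nextPos len) k d (d * n / k) (fun b => classSize k (d * n / k) b / d) ≤
        expect (fun g : Config k d n (d * n / k) =>
          (numSolutions g : ℝ) * (numFamilies len g : ℝ)) /
        expect (fun g : Config k d n (d * n / k) => (numSolutions g : ℝ)) ∧
      expect (fun g : Config k d n (d * n / k) =>
          (numSolutions g : ℝ) * (numFamilies len g : ℝ)) /
        expect (fun g : Config k d n (d * n / k) => (numSolutions g : ℝ)) ≤
      placementMean (nextPos len) k d (d * n / k) (fun b => classSize k (d * n / k) b / d) +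
        overlapConst (Pos len) k d / ((d * n / k : ℕ) : ℝ) := by
    filter_upwards [hadm, hm.eventually_gt_atTop 0,
      hm.eventually_ge_atTop (4 * Fintype.card (Pos len))] with n hn hm0 hP
    obtain ⟨hkm, -⟩ := exists_classes_of_admissible hk hn
    obtain ⟨x₀, hx₀⟩ := exists_balanced hk hn
    have hpos := card_isSolution_pos hk hx₀
    set m := d * n / k
    have hcard : (Fintype.card (Config k d n m) : ℝ) ≠ 0 := by
      have : Nonempty (Config k d n m) := by
        obtain ⟨g⟩ := (Nat.card_pos_iff.mp hpos).1
        exact ⟨g.1⟩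
      exact_mod_cast Fintype.card_ne_zero
    have hZ : ∑ g : Config k d n m, (numSolutions g : ℝ) =
        ∑ x : Fin n → Bool, (Nat.card {g : Config k d n m // IsSolution g x} : ℝ) := by
      have := sum_numSolutions_mul (k := k) (d := d) (n := n) (m := m) fun _ => 1
      simp only [mul_one, Finset.sum_const, nsmul_eq_mul] at this
      simp_rw [this, Nat.card_eq_fintype_card, Fintype.card_subtype]
    have hZ0 : 0 < ∑ x : Fin n → Bool,
        (Nat.card {g : Config k d n m // IsSolution g x} : ℝ) :=
      Finset.sum_pos' (fun _ _ => Nat.cast_nonneg _) ⟨x₀, Finset.mem_univ _, by exact_mod_cast hpos⟩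
    -- the bounds hold for every `x` with the same constants, hence for the average over `x`
    have hb := fun x => sum_numFamilies_bounds (n := n) hlen hk hd (hN n hn) hm0
      (hkm.symm ▸ Nat.le_mul_of_pos_left n (by omega : 0 < d)) hP x
    rw [expect, expect, div_div_div_cancel_right₀ hcard, sum_numSolutions_mul, hZ,
      le_div_iff₀ hZ0, div_le_iff₀ hZ0, mul_comm, Finset.sum_mul, mul_comm, Finset.sum_mul]
    exact ⟨Finset.sum_le_sum fun x _ => (hb x).1, Finset.sum_le_sum fun x _ => (hb x).2⟩
  exact tendsto_of_tendsto_of_tendsto_of_le_of_le' hmean herr (key.mono fun _ h => h.1)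
    (key.mono fun _ h => h.2)

/-- The families of distinct cycles with `r ℓ` members of length `2 * ℓ` for `1 ≤ ℓ ≤ L` are counted
by the falling factorials of the numbers of cycles. -/
theorem numFamilies_sigma {k d n m : ℕ} (L : ℕ) (r : ℕ → ℕ) (g : Config k d n m) :
    numFamilies (fun i : Σ ℓ : Finset.Icc 1 L, Fin (r ℓ) => (i.1 : ℕ)) g =
      ∏ ℓ ∈ Finset.Icc 1 L, (2 * ℓ) ^ r ℓ * (numCycles ℓ g).descFactorial (r ℓ) := by
  rw [← Finset.prod_coe_sort]
  have h : ∀ ℓ : Finset.Icc 1 L, (2 * (ℓ : ℕ)) ^ r ℓ * (numCycles ℓ g).descFactorial (r ℓ) =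
      Nat.card {f : Fin (r ℓ) → DirectedCycle g ℓ // (fun i => (f i).edges).Injective} :=
    fun ℓ => (card_tuples_of_cycles (Finset.mem_Icc.mp ℓ.2).1 g (r ℓ)).symm
  rw [Finset.prod_congr rfl fun ℓ _ => h ℓ, ← Nat.card_pi, numFamilies]
  refine Nat.card_congr
    { toFun := fun γ ℓ => ⟨fun i => γ.1 ⟨ℓ, i⟩, fun i j hij => by
        have := γ.2 hij
        simpa using this⟩
      invFun := fun f => ⟨fun i => (f i.1).1 i.2, ?_⟩
      left_inv := fun γ => rfl
      right_inv := fun f => rfl }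
  rintro ⟨ℓ, i⟩ ⟨ℓ', i'⟩ hij
  have hij : ((f ℓ).1 i).edges = ((f ℓ').1 i').edges := hij
  -- cycles of different lengths have different numbers of edges
  have hℓ : ℓ = ℓ' := by
    have := congrArg Set.ncard hij
    rw [DirectedCycle.ncard_edges, DirectedCycle.ncard_edges] at this
    exact Subtype.ext (by omega)
  subst hℓ
  exact congrArg _ ((f ℓ).2 hij)

/-! ### The parameters and the variance series -/

theorem lam_pos {k d ℓ : ℕ} (hk : 3 < k) (hd : 1 < d) (hℓ : 1 ≤ ℓ) : 0 < lam k d ℓ := by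
  have hk' : (3 : ℝ) < k := by exact_mod_cast hk
  have hd' : (1 : ℝ) < d := by exact_mod_cast hd
  have hℓ' : (1 : ℝ) ≤ ℓ := by exact_mod_cast hℓ
  have h1 : (0 : ℝ) < (k : ℝ) - 1 := by linarith
  have h2 : (0 : ℝ) < (d : ℝ) - 1 := by linarith
  unfold lam
  positivity

theorem neg_one_lt_delta {k ℓ : ℕ} (hk : 3 < k) (hℓ : 1 ≤ ℓ) : -1 < delta k ℓ := by
  have hk' : (3 : ℝ) < k := by exact_mod_cast hk
  have h : |-1 / ((k : ℝ) - 1)| < 1 := by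
    rw [abs_div, abs_neg, abs_one, abs_of_pos (by linarith), div_lt_one (by linarith)]
    linarith
  have := pow_lt_one₀ (abs_nonneg _) h (by omega : ℓ ≠ 0)
  rw [← abs_pow] at this
  exact (abs_lt.mp this).1

theorem hasSum_lam_mul_delta_sq {k d : ℕ} (hk : 3 < k) (hd : 1 < d) (hdk : d < k) :
    HasSum (fun j : ℕ => lam k d (j + 1) * delta k (j + 1) ^ 2)
      (Real.log (Real.sqrt (((k : ℝ) - 1) / ((k : ℝ) - (d : ℝ))))) := by
  have hk' : (3 : ℝ) < k := by exact_mod_cast hk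
  have hd' : (1 : ℝ) < d := by exact_mod_cast hd
  have hdk' : (d : ℝ) < k := by exact_mod_cast hdk
  have h1 : (0 : ℝ) < (k : ℝ) - 1 := by linarith
  have h2 : (0 : ℝ) < (k : ℝ) - d := by linarith
  have hq : |((d : ℝ) - 1) / ((k : ℝ) - 1)| < 1 := by
    rw [abs_of_pos (div_pos (by linarith) h1), div_lt_one h1]
    linarith
  have h := (Real.hasSum_pow_div_log_of_abs_lt_one hq).div_const 2
  have hlog : Real.log (Real.sqrt (((k : ℝ) - 1) / ((k : ℝ) - (d : ℝ)))) =
      -Real.log (1 - ((d : ℝ) - 1) / ((k : ℝ) - 1)) / 2 := by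
    rw [Real.log_sqrt (by positivity), ← Real.log_inv]
    congr 2
    rw [one_sub_div h1.ne', inv_div]
    congr 1
    ring
  rw [hlog]
  refine h.congr_fun ?_
  intro j
  simp only [lam, delta]
  push_cast
  rw [mul_pow, div_pow, div_pow, ← pow_mul, mul_comm (j + 1) 2, pow_mul, neg_one_sq, one_pow,
    div_pow]
  field_simp

end RegularOccupation

open RegularOccupation in
theorem mainTheorem6 (k d : ℕ) (hk : 3 < k) (hd : 1 < d) :
    (∀ ℓ : ℕ, 1 ≤ ℓ →
      0 < RegularOccupation.lam k d ℓ ∧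
      -1 < RegularOccupation.delta k ℓ ∧
      1 + RegularOccupation.delta k ℓ = (RegularOccupation.transition k ^ ℓ).trace) ∧
    (∀ (L : ℕ) (r : ℕ → ℕ),
      (fun n : ℕ =>
        RegularOccupation.expect (fun g : RegularOccupation.Config k d n (d * n / k) =>
          (RegularOccupation.numSolutions g : ℝ) *
            ∏ ℓ ∈ Finset.Icc 1 L,
              ((RegularOccupation.numCycles ℓ g).descFactorial (r ℓ) : ℝ)) /
        RegularOccupation.expect (fun g : RegularOccupation.Config k d n (d * n / k) =>
          (RegularOccupation.numSolutions g : ℝ)))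
      ~[atTop ⊓ 𝓟 (RegularOccupation.admissible k d)]
      (fun _ : ℕ => ∏ ℓ ∈ Finset.Icc 1 L, RegularOccupation.mu k d ℓ ^ r ℓ)) ∧
    (d < k →
      HasSum (fun j : ℕ =>
          RegularOccupation.lam k d (j + 1) * RegularOccupation.delta k (j + 1) ^ 2)
        (Real.log (Real.sqrt (((k : ℝ) - 1) / ((k : ℝ) - (d : ℝ)))))) := by
  refine ⟨fun ℓ hℓ => ⟨lam_pos hk hd hℓ, neg_one_lt_delta hk hℓ, one_add_delta_eq_trace hk ℓ⟩,
    fun L r => ?_, hasSum_lam_mul_delta_sq hk hd⟩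
  have hmu : ∀ ℓ ∈ Finset.Icc 1 L, mu k d ℓ ≠ 0 := fun ℓ hℓ => by
    have h1 := (Finset.mem_Icc.mp hℓ).1
    have := neg_one_lt_delta hk h1
    exact (mul_pos (lam_pos hk hd h1) (by linarith)).ne'
  refine (isEquivalent_const_iff_tendsto
    (Finset.prod_ne_zero_iff.mpr fun ℓ hℓ => pow_ne_zero _ (hmu ℓ hℓ))).mpr ?_
  have hlen : ∀ i : Σ ℓ : Finset.Icc 1 L, Fin (r ℓ), 0 < (i.1 : ℕ) :=
    fun i => (Finset.mem_Icc.mp i.1.2).1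
  set c : ℝ := ∏ ℓ ∈ Finset.Icc 1 L, (2 * (ℓ : ℝ)) ^ r ℓ with hc
  have hc0 : c ≠ 0 := by
    refine Finset.prod_ne_zero_iff.mpr fun ℓ hℓ => pow_ne_zero _ ?_
    have : (1 : ℝ) ≤ ℓ := by exact_mod_cast (Finset.mem_Icc.mp hℓ).1
    linarith
  have h := (tendsto_expect_numFamilies hlen hk hd).div_const c
  have hlim : (∏ i : Σ ℓ : Finset.Icc 1 L, Fin (r ℓ), ((((k : ℝ) - 1) * ((d : ℝ) - 1)) ^ (i.1 : ℕ) *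
      (1 + delta k i.1))) / c = ∏ ℓ ∈ Finset.Icc 1 L, mu k d ℓ ^ r ℓ := by
    rw [div_eq_iff hc0, hc, ← Finset.prod_mul_distrib, Fintype.prod_sigma,
      ← Finset.prod_coe_sort (Finset.Icc 1 L)]
    refine Finset.prod_congr rfl fun ℓ _ => ?_
    have : ((ℓ : ℕ) : ℝ) ≠ 0 := by
      have := (Finset.mem_Icc.mp ℓ.2).1
      exact_mod_cast (by omega : (ℓ : ℕ) ≠ 0)
    simp only [Finset.prod_const, Finset.card_univ, Fintype.card_fin]
    rw [← mul_pow, mu, lam]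
    congr 1
    field_simp
  rw [hlim] at h
  refine h.congr fun n => ?_
  rw [div_right_comm]
  congr 1
  rw [div_eq_iff hc0, expect, expect, div_mul_eq_mul_div, Finset.sum_mul]
  congr 1
  refine Finset.sum_congr rfl fun g _ => ?_
  rw [numFamilies_sigma, hc, mul_assoc, ← Finset.prod_mul_distrib]
  push_cast
  congr 1
  exact Finset.prod_congr rfl fun ℓ _ => mul_comm _ _
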